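/- All graphs are finite and simple. A hole is a chordless cycle of length at least $4$, and a $4$-hole is a hole of length $4$. A cap is a graph consisting of a hole $H$ and a vertex $x \notin H$ that has exactly two neighbours in $H$, these two being adjacent. A graph is $F$-free if it has no induced subgraph isomorphic to $F$. A clique cutset of a graph $G$ is a (possibly empty) set $K$ of pairwise adjacent vertices such that $G \setminus K$ is disconnected (has two vertices not joined by a path). Blowing up the vertices of a graph $F$ into cliques means replacing every vertex $u$ of $F$ by a nonempty clique $K_u$, the cliques being pairwise disjoint, with all edges between $K_u$ and $K_v$ if $uv \in E(F)$ and none otherwise (for $u \ne v$). Adding a universal clique to a graph means adding a possibly empty set of new vertices that are pairwise adjacent and adjacent to all vertices of the graph. Theorem. Let $G$ be a (cap, $4$-hole)-free graph that contains a hole and has no clique cutset. Let $F$ be any (inclusion-wise) maximal member of the family of induced subgraphs of $G$ that have at least $3$ vertices, are triangle-free and have no clique cutset. Then $G$ is obtained from $F$ by first blowing up the vertices of $F$ into cliques (the clique $K_u$ replacing a vertex $u$ of $F$ containing $u$ itself) and then adding a universal clique. Furthermore, any graph obtained by this sequence of operations (up to isomorphism) from a (triangle, $4$-hole)-free graph with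 at least $3$ vertices and no clique cutset is (cap, $4$-hole)-free and has no clique cutset. -/

import Mathlib

universe u v w x

namespace CapFree

/-- `G` contains a hole: an induced (i.e. chordless) cycle of length at least four. -/
def ContainsHole {V : Type*} (G : SimpleGraph V) : Prop :=
  ∃ n : ℕ, 4 ≤ n ∧ Nonempty (SimpleGraph.cycleGraph n ↪g G)

/-- `G` contains no induced cycle on four vertices. -/
def FourHoleFree {V : Type*} (G : SimpleGraph V) : Prop :=
  IsEmpty (SimpleGraph.cycleGraph 4 ↪g G)

/-- `G` contains a cap: a hole (the image of `f`) together with a further vertex `x` that has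
exactly two neighbours `f i` and `f j` on the hole, and these are adjacent. -/
def ContainsCap {V : Type*} (G : SimpleGraph V) : Prop :=
  ∃ n : ℕ, 4 ≤ n ∧ ∃ f : SimpleGraph.cycleGraph n ↪g G, ∃ x : V, x ∉ Set.range f ∧
    ∃ i j : Fin n, G.Adj (f i) (f j) ∧ ∀ k : Fin n, G.Adj x (f k) ↔ (k = i ∨ k = j)

/-- `G` is (cap, 4-hole)-free. -/
def CapFourHoleFree {V : Type*} (G : SimpleGraph V) : Prop :=
  ¬ ContainsCap G ∧ FourHoleFree G

/-- `G` has a clique cutset: a (possibly empty) clique whose deletion leaves a disconnected graph,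
that is, a graph in which some two vertices are joined by no path. -/
def HasCliqueCutset {V : Type*} (G : SimpleGraph V) : Prop :=
  ∃ K : Set V, G.IsClique K ∧ ¬ (G.induce Kᶜ).Preconnected

/-- The graph obtained from `F` by replacing every vertex `u` by a clique on the set `K u`,
with all edges between `K u` and `K v` when `u v` is an edge of `F`, and none otherwise. -/
def blowUp {W : Type*} (F : SimpleGraph W) (K : W → Type*) : SimpleGraph (Σ u, K u) where
  Adj p q := (p.1 = q.1 ∧ p ≠ q) ∨ F.Adj p.1 q.1
  symm := ⟨fun _ _ h => h.elim (fun h => Or.inl ⟨h.1.symm, h.2.symm⟩) (fun h => Or.inr h.symm)⟩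
  loopless := ⟨fun _ h => h.elim (fun h => h.2 rfl) (fun h => F.loopless.irrefl _ h)⟩

/-- The graph obtained from `G` by adding a (possibly empty) clique on the set `U`, all of whose
vertices are adjacent to all vertices of `G`. -/
def addUniversalClique {V : Type*} (G : SimpleGraph V) (U : Type*) : SimpleGraph (V ⊕ U) where
  Adj
    | .inl v, .inl w => G.Adj v w
    | .inr a, .inr b => a ≠ b
    | .inl _, .inr _ => True
    | .inr _, .inl _ => True
  symm := ⟨fun p q h => by
    rcases p with v | a <;> rcases q with w | b
    · exact SimpleGraph.Adj.symm (G := G) h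
    · trivial
    · trivial
    · exact Ne.symm h⟩
  loopless := ⟨fun p h => by
    rcases p with v | a
    · exact G.loopless.irrefl v h
    · exact h rfl⟩

/-- The induced subgraph of `G` on the vertex set `S` has at least 3 vertices, is triangle-free
and has no clique cutset. -/
def IsTriangleFreeAtom {V : Type*} (G : SimpleGraph V) (S : Set V) : Prop :=
  3 ≤ S.ncard ∧ (G.induce S).CliqueFree 3 ∧ ¬ HasCliqueCutset (G.induce S)

end CapFree

/-!
Throughout, `S` is the vertex set of a triangle-free subgraph `F` of `G` without clique cutset.

*From `G` to `F`.* The basic step is that a vertex outside `S` with two adjacent neighbours in `S`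
is complete to `S` or has there the neighbourhood of a twin of some `c ∈ S`
(`IsAtomIn.complete_or_twin`). Indeed, let `M` be the neighbourhood of `v` in `S`. If `M ≠ S`,
consider the components of `S \ M`. Two adjacent vertices of `M` never attach to the same component
(otherwise a shortest path through it gives a cap with `v`); as `F` has no cut vertex, each
component has at least two attachments, which therefore are nonadjacent, and the absence of caps
and 4-holes forces them to share a common neighbourhood in `M`, of at most one vertex. If that
vertex is `c`, then the neighbours of `c` in `M` with no other neighbour in `M`, together with the
components attached to them, are separated by `c` from the remainder of `F`, which is thus empty.

Next, a vertex outside `S` with an independent neighbourhood of size at least two in `S` enlarges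
the atom. So, for `S` maximal, the vertices of `G` are the twins of vertices of `S` (grouped in
`twinClass`), the vertices complete to `S`, and a `residue` of vertices with at most one neighbour
in `S`. Caps and 4-holes determine the adjacencies among the first two kinds
(`IsAtomIn.twin_adj_twin_iff`, `IsAtomIn.adj_of_complete`). If a component of the residue attached
to twins of two nonadjacent `u, u' ∈ S`, then on a shortest path between two such twins the ends
are adjacent to `u` and `u'` themselves (otherwise `IsAtomIn.false_of_link` gives a cap) and the
inner vertices attach to common neighbours of `u` and `u'` only. Such a path is an ear that enlarges
the atom (`false_of_ear`). Hence every component of the residue has a clique as its neighbourhood,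
which is a clique cutset of `G`; so the residue is empty.

*From `F` to `G`.* A hole of a blow-up with a universal clique projects to a hole of `F`
(`IsBlowUpMap.exists_hole`), since a hole has neither two vertices with the same closed
neighbourhood nor a vertex adjacent to all others. The vertex of a cap outside its
hole would form a triangle of `F` with the two vertices it sees, and a clique cutset yields one
of `F`.
-/

namespace CapFree

/-! ### Induced paths, holes and caps -/

/-- The vertices `p 0, …, p n` are distinct and induce a path of `G`, in this order. The values of
`p` beyond `n` are irrelevant. -/
def IsIndPath {V : Type*} (G : SimpleGraph V) (n : ℕ) (p : ℕ → V) : Prop :=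
  ∀ i j, i < j → j ≤ n → p i ≠ p j ∧ (G.Adj (p i) (p j) ↔ j = i + 1)

/-- The sequence `v, p 0, p 1, …`. -/
def consSeq {V : Type*} (v : V) (p : ℕ → V) : ℕ → V
  | 0 => v
  | i + 1 => p i

@[simp] lemma consSeq_zero {V : Type*} (v : V) (p : ℕ → V) : consSeq v p 0 = v := rfl

@[simp] lemma consSeq_succ {V : Type*} (v : V) (p : ℕ → V) (i : ℕ) :
    consSeq v p (i + 1) = p i := rfl

section Paths

variable {V : Type*} {G : SimpleGraph V} {n : ℕ} {p : ℕ → V}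

lemma IsIndPath.cons (hp : IsIndPath G n p) {v : V}
    (hv : ∀ i ≤ n, v ≠ p i ∧ (G.Adj v (p i) ↔ i = 0)) : IsIndPath G (n + 1) (consSeq v p) := by
  intro i j hij hj
  obtain ⟨j, rfl⟩ : ∃ k, j = k + 1 := ⟨j - 1, by omega⟩
  rcases i with _ | i
  · have := hv j (by omega)
    simp only [consSeq_zero, consSeq_succ]
    exact ⟨this.1, this.2.trans (by omega)⟩
  · have := hp i j (by omega) (by omega)
    simp only [consSeq_succ]
    exact ⟨this.1, this.2.trans (by omega)⟩

lemma IsIndPath.reverse (hp : IsIndPath G n p) : IsIndPath G n (fun i => p (n - i)) := by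
  intro i j hij hj
  have := hp (n - j) (n - i) (by omega) (by omega)
  exact ⟨this.1.symm, (G.adj_comm _ _).trans (this.2.trans (by omega))⟩

lemma IsIndPath.shift (hp : IsIndPath G n p) {k m : ℕ} (h : k + m ≤ n) :
    IsIndPath G m (fun i => p (k + i)) := by
  intro i j hij hj
  have := hp (k + i) (k + j) (by omega) (by omega)
  exact ⟨this.1, this.2.trans (by omega)⟩

lemma IsIndPath.adj_succ (hp : IsIndPath G n p) {i : ℕ} (hi : i < n) : G.Adj (p i) (p (i + 1)) :=
  (hp i (i + 1) (by omega) (by omega)).2.2 rfl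

lemma cycleGraph_adj_of_lt {n : ℕ} {i j : Fin n} (hij : i < j) :
    (SimpleGraph.cycleGraph n).Adj i j ↔ (j.val = i.val + 1 ∨ (i.val = 0 ∧ j.val + 1 = n)) := by
  have h1 := i.2
  have h2 := j.2
  have h3 : i.val < j.val := hij
  rw [SimpleGraph.cycleGraph_adj', Fin.coe_sub_iff_le.2 hij.le, Fin.coe_sub_iff_lt.2 hij]
  omega

/-- A vertex whose neighbours on an induced path are exactly its two ends closes it to a hole. -/
def holeEmbedding (hp : IsIndPath G n p) {v : V}
    (hv : ∀ i ≤ n, v ≠ p i ∧ (G.Adj v (p i) ↔ i = 0 ∨ i = n)) :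
    SimpleGraph.cycleGraph (n + 2) ↪g G := by
  have key' : ∀ i j : ℕ, i < j → j < n + 2 → consSeq v p i ≠ consSeq v p j ∧
      (G.Adj (consSeq v p i) (consSeq v p j) ↔ (j = i + 1 ∨ i = 0 ∧ j + 1 = n + 2)) := by
    intro i j hij hj
    obtain ⟨j, rfl⟩ : ∃ k, j = k + 1 := ⟨j - 1, by omega⟩
    rcases i with _ | i
    · have := hv j (by omega)
      simp only [consSeq_zero, consSeq_succ, true_and]
      refine ⟨this.1, this.2.trans ?_⟩
      omega
    · have := hp i j (by omega) (by omega)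
      simp only [consSeq_succ]
      exact ⟨this.1, this.2.trans (by omega)⟩
  have key : ∀ i j : Fin (n + 2), i < j → consSeq v p i ≠ consSeq v p j ∧
      (G.Adj (consSeq v p i) (consSeq v p j) ↔ (SimpleGraph.cycleGraph (n + 2)).Adj i j) := by
    intro i j hij
    rw [cycleGraph_adj_of_lt hij]
    exact key' i j hij j.2
  refine ⟨⟨fun i => consSeq v p i, ?_⟩, ?_⟩
  · intro i j h
    rcases lt_trichotomy i j with h' | h' | h'
    · exact absurd h (key i j h').1
    · exact h'
    · exact absurd h.symm (key j i h').1
  · intro i j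
    rcases lt_trichotomy i j with h' | rfl | h'
    · exact (key i j h').2
    · simp
    · rw [SimpleGraph.adj_comm, SimpleGraph.adj_comm _ i]
      exact (key j i h').2

lemma holeEmbedding_apply (hp : IsIndPath G n p) {v : V}
    (hv : ∀ i ≤ n, v ≠ p i ∧ (G.Adj v (p i) ↔ i = 0 ∨ i = n)) (i : Fin (n + 2)) :
    holeEmbedding hp hv i = consSeq v p i := rfl

/-- The hole `v, p 0, …, p n` together with a vertex `x` attached exactly to `v` and `p 0` is a
cap. -/
lemma false_of_cap (hG : ¬ ContainsCap G) (hn : 2 ≤ n) (hp : IsIndPath G n p) {v x : V}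
    (hv : ∀ i ≤ n, v ≠ p i ∧ (G.Adj v (p i) ↔ i = 0 ∨ i = n))
    (hxv : G.Adj x v) (hx : ∀ i ≤ n, x ≠ p i ∧ (G.Adj x (p i) ↔ i = 0)) : False := by
  refine hG ⟨n + 2, by omega, holeEmbedding hp hv, x, ?_, 0, 1, ?_, ?_⟩
  · rintro ⟨⟨i, hi⟩, h⟩
    rw [holeEmbedding_apply] at h
    rcases i with _ | i
    · exact hxv.ne h.symm
    · exact (hx i (by omega)).1 h.symm
  · rw [holeEmbedding_apply, holeEmbedding_apply]
    exact (hv 0 (by omega)).2.2 (Or.inl rfl)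
  · rintro ⟨i, hi⟩
    rw [holeEmbedding_apply]
    rcases i with _ | i
    · simpa using hxv
    · simp only [consSeq_succ, Fin.ext_iff, Fin.val_zero, Fin.val_one]
      rw [(hx i (by omega)).2]
      omega

lemma false_of_fourHole (hG : FourHoleFree G) {a b c d : V} (hab : G.Adj a b) (hbc : G.Adj b c)
    (hcd : G.Adj c d) (hda : G.Adj d a) (hac : ¬ G.Adj a c) (hbd : ¬ G.Adj b d)
    (hac' : a ≠ c) (hbd' : b ≠ d) : False := by
  have hp : IsIndPath G 2 (consSeq b (consSeq c (fun _ => d))) := by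
    refine IsIndPath.cons (n := 1) (IsIndPath.cons (n := 0) ?_ ?_) ?_
    · intro i j h h'
      omega
    · intro i hi
      obtain rfl : i = 0 := by omega
      exact ⟨hcd.ne, by simp [hcd]⟩
    · intro i hi
      rcases i with _ | _ | i
      · exact ⟨hbc.ne, by simp [hbc]⟩
      · exact ⟨hbd', by simp [hbd]⟩
      · omega
  refine hG.false (holeEmbedding (v := a) hp ?_)
  intro i hi
  rcases i with _ | _ | _ | i
  · exact ⟨hab.ne, by simp [hab]⟩
  · exact ⟨hac', by simp [hac]⟩
  · exact ⟨hda.ne.symm, by simp [hda.symm]⟩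
  · omega

/-- In the hole formed by the edge `c a` and the path `p` from a neighbour of `c` to a neighbour
of `a`, a vertex sees exactly `c` and `a`. -/
lemma false_of_cap_edge (hG : ¬ ContainsCap G) (hn : 1 ≤ n) (hp : IsIndPath G n p) {c a w : V}
    (hca : G.Adj c a) (hc : ∀ i ≤ n, c ≠ p i ∧ (G.Adj c (p i) ↔ i = 0))
    (ha : ∀ i ≤ n, a ≠ p i ∧ (G.Adj a (p i) ↔ i = n))
    (hwc : G.Adj w c) (hwa : G.Adj w a) (hw : ∀ i ≤ n, w ≠ p i ∧ ¬ G.Adj w (p i)) : False := by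
  refine false_of_cap hG (n := n + 1) (by omega) (hp.cons hc) (v := a) (x := w) ?_ hwa ?_
  · intro i hi
    rcases i with _ | i
    · exact ⟨hca.ne.symm, by simp [hca.symm]⟩
    · have := ha i (by omega)
      exact ⟨this.1, this.2.trans (by omega)⟩
  · intro i hi
    rcases i with _ | i
    · exact ⟨hwc.ne, by simp [hwc]⟩
    · have := hw i (by omega)
      exact ⟨this.1, by simp [this.2]⟩

/-- In the hole formed by the edge `c a` and the path `p` from a neighbour of `c` to a neighbour
of `a`, a vertex sees exactly `a` and the last vertex of `p`. -/
lemma false_of_cap_last (hG : ¬ ContainsCap G) (hn : 1 ≤ n) (hp : IsIndPath G n p) {c a w : V}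
    (hca : G.Adj c a) (hc : ∀ i ≤ n, c ≠ p i ∧ (G.Adj c (p i) ↔ i = 0))
    (ha : ∀ i ≤ n, a ≠ p i ∧ (G.Adj a (p i) ↔ i = n))
    (hwc : w ≠ c ∧ ¬ G.Adj w c) (hwa : G.Adj w a)
    (hw : ∀ i ≤ n, w ≠ p i ∧ (G.Adj w (p i) ↔ i = n)) : False := by
  refine false_of_cap hG (n := n + 1) (by omega) (hp.cons hc).reverse (v := a) (x := w) ?_ hwa ?_
  · intro i hi
    obtain ⟨j, hj, hj'⟩ : ∃ j, n + 1 - i = j ∧ i = n + 1 - j := ⟨_, rfl, by omega⟩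
    rw [hj]
    rcases j with _ | j
    · exact ⟨hca.ne.symm, by simp [hca.symm]; omega⟩
    · have := ha j (by omega)
      exact ⟨this.1, this.2.trans (by omega)⟩
  · intro i hi
    obtain ⟨j, hj, hj'⟩ : ∃ j, n + 1 - i = j ∧ i = n + 1 - j := ⟨_, rfl, by omega⟩
    rw [hj]
    rcases j with _ | j
    · exact ⟨hwc.1, by simp [hwc.2]; omega⟩
    · have := hw j (by omega)
      exact ⟨this.1, this.2.trans (by omega)⟩

end Paths

/-! ### Shortest paths in a set of vertices -/

/-- The vertices `a` and `b` of `D` are joined by a path inside `D`; for `a = b` nothing is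
required, so membership of the end vertices has to be stated separately. -/
def Linked {V : Type*} (G : SimpleGraph V) (D : Set V) : V → V → Prop :=
  Relation.ReflTransGen fun a b => a ∈ D ∧ b ∈ D ∧ G.Adj a b

section Linked

variable {V : Type*} {G : SimpleGraph V} {D : Set V}

lemma Linked.symm {a b : V} (h : Linked G D a b) : Linked G D b a :=
  have : Std.Symm fun a b => a ∈ D ∧ b ∈ D ∧ G.Adj a b := ⟨fun _ _ h => ⟨h.2.1, h.1, h.2.2.symm⟩⟩
  Relation.ReflTransGen.stdSymm.symm _ _ h

lemma Linked.mem {a b : V} (h : Linked G D a b) (ha : a ∈ D) : b ∈ D := by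
  induction h with
  | refl => exact ha
  | tail _ h _ => exact h.2.1

lemma Linked.step {a b c : V} (h : Linked G D a b) (ha : a ∈ D) (hc : c ∈ D) (hbc : G.Adj b c) :
    Linked G D a c :=
  Relation.ReflTransGen.tail h ⟨h.mem ha, hc, hbc⟩

lemma Linked.exists_walk {a b : V} (h : Linked G D a b) (ha : a ∈ D) :
    ∃ (n : ℕ) (p : ℕ → V), p 0 = a ∧ p n = b ∧ (∀ i ≤ n, p i ∈ D) ∧
      ∀ i < n, G.Adj (p i) (p (i + 1)) := by
  induction h using Relation.ReflTransGen.head_induction_on with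
  | refl => exact ⟨0, fun _ => b, rfl, rfl, fun _ _ => ha, fun i hi => by omega⟩
  | @head a c hac _ ih =>
    obtain ⟨n, p, h0, hn, hD, hadj⟩ := ih hac.2.1
    refine ⟨n + 1, consSeq a p, rfl, hn, ?_, ?_⟩
    · rintro (_ | i) hi
      · exact ha
      · exact hD i (by omega)
    · rintro (_ | i) hi
      · simpa [h0] using hac.2.2
      · exact hadj i (by omega)

lemma linked_of_walk {n : ℕ} {p : ℕ → V} (hD : ∀ i ≤ n, p i ∈ D)
    (hadj : ∀ i < n, G.Adj (p i) (p (i + 1))) {i : ℕ} (hi : i ≤ n) :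
    Linked G D (p 0) (p i) := by
  induction i with
  | zero => exact Relation.ReflTransGen.refl
  | succ i ih => exact (ih (by omega)).step (hD 0 (by omega)) (hD _ hi) (hadj i (by omega))

/-- If two vertices in the relation `R` are linked in `D`, then a shortest walk in `D` between two
such vertices is an induced path, and only its two ends are in the relation. -/
lemma exists_indPath_rel (R : V → V → Prop) {a b : V} (ha : a ∈ D) (hR : R a b)
    (h : Linked G D a b) :
    ∃ (n : ℕ) (p : ℕ → V), IsIndPath G n p ∧ (∀ i ≤ n, p i ∈ D) ∧ R (p 0) (p n) ∧
      ∀ i j, i ≤ j → j ≤ n → R (p i) (p j) → i = 0 ∧ j = n := by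
  classical
  let Q : ℕ → Prop := fun n => ∃ p : ℕ → V, (∀ i ≤ n, p i ∈ D) ∧
    (∀ i < n, G.Adj (p i) (p (i + 1))) ∧ R (p 0) (p n)
  have hQ : ∃ n, Q n := by
    obtain ⟨n, p, h0, hn, hD, hadj⟩ := h.exists_walk ha
    exact ⟨n, p, hD, hadj, by rwa [h0, hn]⟩
  obtain ⟨n, ⟨p, hD, hadj, hpR⟩, hmin⟩ : ∃ n, Q n ∧ ∀ m < n, ¬ Q m :=
    ⟨Nat.find hQ, Nat.find_spec hQ, fun m hm => Nat.find_min hQ hm⟩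
  -- Leaving out the vertices strictly between `p i` and `p (i + k + 1)` gives a shorter walk.
  have short : ∀ i k, 0 < k → i + k + 1 ≤ n → ¬ G.Adj (p i) (p (i + k + 1)) := by
    intro i k hk hn hik
    refine hmin (n - k) (by omega) ⟨fun t => if t ≤ i then p t else p (t + k), ?_, ?_, ?_⟩
    · intro t ht
      dsimp only
      split_ifs
      · exact hD t (by omega)
      · exact hD _ (by omega)
    · intro t ht
      dsimp only
      rcases lt_trichotomy t i with h | rfl | h
      · rw [if_pos (by omega), if_pos (by omega)]
        exact hadj t (by omega)
      · rw [if_pos le_rfl, if_neg (by omega)]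
        convert hik using 2
        omega
      · rw [if_neg (by omega), if_neg (by omega)]
        have := hadj (t + k) (by omega)
        rwa [show t + k + 1 = t + 1 + k by omega] at this
    · dsimp only
      rw [if_pos (by omega), if_neg (by omega), Nat.sub_add_cancel (by omega)]
      exact hpR
  have ends : ∀ i j, i ≤ j → j ≤ n → R (p i) (p j) → i = 0 ∧ j = n := by
    intro i j hij hj hRij
    by_contra hne
    refine hmin (j - i) (by omega) ⟨fun t => p (i + t), ?_, ?_, ?_⟩
    · exact fun t ht => hD _ (by omega)
    · exact fun t ht => hadj (i + t) (by omega)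
    · simpa [Nat.add_sub_cancel' hij] using hRij
  refine ⟨n, p, fun i j hij hj => ⟨fun heq => ?_, fun hij' => ?_, ?_⟩, hD, hpR, ends⟩
  · rcases Nat.lt_or_ge j n with hjn | hjn
    · have := hadj j hjn
      rw [← heq] at this
      obtain ⟨k, rfl⟩ : ∃ k, j = i + k := ⟨j - i, by omega⟩
      exact short i k (by omega) (by omega) this
    · obtain rfl : j = n := by omega
      have := ends 0 i (by omega) (by omega) (by rwa [heq])
      omega
  · by_contra hne
    obtain ⟨k, rfl⟩ : ∃ k, j = i + k + 1 := ⟨j - i - 1, by omega⟩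
    exact short i k (by omega) (by omega) hij'
  · rintro rfl
    exact hadj i (by omega)

lemma exists_indPath_sets (A B : Set V) {a b : V} (ha : a ∈ D) (hA : a ∈ A) (hB : b ∈ B)
    (h : Linked G D a b) :
    ∃ (n : ℕ) (p : ℕ → V), IsIndPath G n p ∧ (∀ i ≤ n, p i ∈ D) ∧
      (∀ i ≤ n, p i ∈ A ↔ i = 0) ∧ ∀ i ≤ n, p i ∈ B ↔ i = n := by
  obtain ⟨n, p, hp, hD, hR, hmin⟩ := exists_indPath_rel (fun a b => a ∈ A ∧ b ∈ B) ha ⟨hA, hB⟩ h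
  refine ⟨n, p, hp, hD, fun i hi => ⟨fun h => ?_, ?_⟩, fun i hi => ⟨fun h => ?_, ?_⟩⟩
  · exact (hmin i n hi le_rfl ⟨h, hR.2⟩).1
  · rintro rfl
    exact hR.1
  · exact (hmin 0 i (by omega) hi ⟨hR.1, h⟩).2
  · rintro rfl
    exact hR.2

end Linked

/-! ### Clique cutsets -/

lemma not_hasCliqueCutset_iff {V : Type*} {G : SimpleGraph V} :
    ¬ HasCliqueCutset G ↔ ∀ K A : Set V, G.IsClique K → A.Nonempty → (∀ a ∈ A, a ∉ K) →
      (∀ a ∈ A, ∀ b, b ∉ K → G.Adj a b → b ∈ A) → ∀ b, b ∉ K → b ∈ A := by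
  constructor
  · rintro h K A hK ⟨a, ha⟩ hAK hcl b hb
    have hpre : (G.induce Kᶜ).Preconnected := by
      by_contra hc
      exact h ⟨K, hK, hc⟩
    have := (SimpleGraph.reachable_iff_reflTransGen _ _).1 (hpre ⟨a, hAK a ha⟩ ⟨b, hb⟩)
    suffices H : ∀ c : (Kᶜ : Set V), Relation.ReflTransGen (G.induce Kᶜ).Adj ⟨a, hAK a ha⟩ c →
        (c : V) ∈ A from H _ this
    intro c hc
    induction hc with
    | refl => exact ha
    | @tail c d _ hcd ih => exact hcl c ih d d.2 hcd
  · rintro h ⟨K, hK, hc⟩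
    refine hc fun a b => ?_
    have := h K {c | ∃ hc : c ∈ Kᶜ, (G.induce Kᶜ).Reachable a ⟨c, hc⟩} hK
      ⟨a, a.2, SimpleGraph.Reachable.refl _⟩ (fun c hc => hc.1) ?_ b b.2
    · exact this.2
    · rintro c ⟨hc, hac⟩ d hd hcd
      refine ⟨hd, hac.trans (SimpleGraph.Adj.reachable ?_)⟩
      exact hcd

/-- `G[S]` has no clique cutset, phrased inside `G`: outside a clique `K ⊆ S`, a nonempty set
closed under adjacency in `S \ K` is all of `S \ K`. -/
def AtomOn {V : Type*} (G : SimpleGraph V) (S : Set V) : Prop :=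
  ∀ K A : Set V, K ⊆ S → A ⊆ S → G.IsClique K → A.Nonempty → (∀ a ∈ A, a ∉ K) →
    (∀ a ∈ A, ∀ b ∈ S, b ∉ K → G.Adj a b → b ∈ A) → ∀ b ∈ S, b ∉ K → b ∈ A

lemma not_hasCliqueCutset_induce_iff {V : Type*} {G : SimpleGraph V} {S : Set V} :
    ¬ HasCliqueCutset (G.induce S) ↔ AtomOn G S := by
  rw [not_hasCliqueCutset_iff]
  constructor
  · intro h K A hK hA hKc hne hd hcl b hb hbK
    obtain ⟨a, ha⟩ := hne
    refine h (Subtype.val ⁻¹' K) (Subtype.val ⁻¹' A) ?_ ⟨⟨a, hA ha⟩, ha⟩ (fun c hc => hd c hc)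
      (fun c hc d hdK hcd => hcl c hc d d.2 hdK hcd) ⟨b, hb⟩ hbK
    intro c hc d hd hcd
    exact hKc hc hd (fun h => hcd (Subtype.ext h))
  · intro h K A hK hne hd hcl b hb
    have := h (Subtype.val '' K) (Subtype.val '' A) (by simp) (by simp) ?_ (hne.image _) ?_ ?_ b b.2
      (by simpa using hb)
    · simpa using this
    · rintro _ ⟨c, hc, rfl⟩ _ ⟨d, hd, rfl⟩ hcd
      exact hK hc hd (fun h => hcd (by rw [h]))
    · rintro _ ⟨c, hc, rfl⟩
      simpa using hd c hc
    · rintro _ ⟨c, hc, rfl⟩ d hdS hdK hcd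
      refine ⟨⟨d, hdS⟩, hcl c hc _ ?_ hcd, rfl⟩
      exact fun h => hdK ⟨_, h, rfl⟩

lemma cliqueFree_induce_iff {V : Type*} {G : SimpleGraph V} {S : Set V} :
    (G.induce S).CliqueFree 3 ↔
      ∀ a ∈ S, ∀ b ∈ S, ∀ c ∈ S, G.Adj a b → G.Adj a c → G.Adj b c → False := by
  classical
  constructor
  · intro h a ha b hb c hc hab hac hbc
    exact h {(⟨a, ha⟩ : S), ⟨b, hb⟩, ⟨c, hc⟩} (SimpleGraph.is3Clique_triple_iff.2
      ⟨SimpleGraph.induce_adj.2 hab, SimpleGraph.induce_adj.2 hac, SimpleGraph.induce_adj.2 hbc⟩)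
  · intro h s hs
    obtain ⟨a, b, c, hab, hac, hbc, -⟩ := SimpleGraph.is3Clique_iff.1 hs
    exact h a a.2 b b.2 c c.2 hab hac hbc

/-! ### How a vertex attaches to a triangle-free atom -/

/-- `G` is (cap, 4-hole)-free, and `S` induces in it a triangle-free subgraph with at least three
vertices and no clique cutset. -/
structure IsAtomIn {V : Type*} (G : SimpleGraph V) (S : Set V) : Prop where
  noCap : ¬ ContainsCap G
  noFourHole : FourHoleFree G
  three_le : 3 ≤ S.ncard
  noTriangle : ∀ a ∈ S, ∀ b ∈ S, ∀ c ∈ S, G.Adj a b → G.Adj a c → G.Adj b c → False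
  atomOn : AtomOn G S

namespace IsAtomIn

variable {V : Type*} {G : SimpleGraph V} {S : Set V}

lemma exists_mem_ne_ne (h : IsAtomIn G S) (a b : V) : ∃ c ∈ S, c ≠ a ∧ c ≠ b := by
  by_contra! hc
  have hsub : S ⊆ {a, b} := by
    intro c hcS
    by_cases hca : c = a
    · exact Or.inl hca
    · exact Or.inr (hc c hcS hca)
  have h1 := Set.ncard_le_ncard hsub (Set.toFinite _)
  have h2 := Set.ncard_insert_le a {b}
  have h3 := h.three_le
  rw [Set.ncard_singleton] at h2
  omega

lemma exists_adj_ne (h : IsAtomIn G S) {u : V} (hu : u ∈ S) (a : V) :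
    ∃ b ∈ S, b ≠ a ∧ G.Adj u b := by
  by_contra! hc
  obtain ⟨c, hcS, hca, hcu⟩ := h.exists_mem_ne_ne a u
  refine hcu (h.atomOn {x | x = a ∧ x ∈ S ∧ x ≠ u} {u} (fun x hx => hx.2.1) (by simpa using hu) ?_
    ⟨u, rfl⟩ ?_ ?_ c hcS (fun hx => hca hx.1))
  · rintro x ⟨rfl, -⟩ y ⟨rfl, -⟩ hxy
    exact absurd rfl hxy
  · rintro x rfl hx
    exact hx.2.2 rfl
  · rintro x rfl b hb hbK hxb
    by_contra hne
    refine hbK ⟨?_, hb, hne⟩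
    by_contra hba
    exact hc b hb hba hxb

/-- Every vertex of the atom has two nonadjacent neighbours in it. -/
lemma exists_two_adj (h : IsAtomIn G S) {u : V} (hu : u ∈ S) :
    ∃ a ∈ S, ∃ b ∈ S, a ≠ b ∧ G.Adj u a ∧ G.Adj u b ∧ ¬ G.Adj a b := by
  obtain ⟨a, ha, -, hua⟩ := h.exists_adj_ne hu u
  obtain ⟨b, hb, hba, hub⟩ := h.exists_adj_ne hu a
  exact ⟨a, ha, b, hb, hba.symm, hua, hub, h.noTriangle u hu a ha b hb hua hub⟩

lemma exists_not_adj (h : IsAtomIn G S) {u : V} (hu : u ∈ S) :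
    ∃ s ∈ S, s ≠ u ∧ ¬ G.Adj u s := by
  obtain ⟨a, ha, -, hua⟩ := h.exists_adj_ne hu u
  obtain ⟨b, hb, hbu, hab⟩ := h.exists_adj_ne ha u
  exact ⟨b, hb, hbu, fun hub => h.noTriangle u hu a ha b hb hua hub hab⟩

lemma common_adj_unique (h : IsAtomIn G S) {a b c d : V} (hc : c ∈ S) (hd : d ∈ S)
    (ha : a ∈ S) (hab : a ≠ b) (hnab : ¬ G.Adj a b) (hac : G.Adj a c) (had : G.Adj a d)
    (hbc : G.Adj b c) (hbd : G.Adj b d) : c = d := by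
  by_contra hcd
  exact false_of_fourHole h.noFourHole hac hbc.symm hbd had.symm hnab
    (fun hcd' => h.noTriangle a ha c hc d hd hac had hcd') hab hcd

section Attach

variable {v : V}

/-- Two adjacent neighbours `a`, `c` of `v` in the atom cannot both attach to the same connected
piece of non-neighbours of `v`: a shortest path between them through the piece would close to a
hole, on which `v` sees exactly `a` and `c`. -/
lemma false_of_adj_attach (h : IsAtomIn G S) (hvS : v ∉ S) {a c d d' : V} (ha : a ∈ S)
    (hc : c ∈ S) (hva : G.Adj v a) (hvc : G.Adj v c) (hac : G.Adj a c)
    (hd : d ∈ S ∧ ¬ G.Adj v d) (hdd' : Linked G {s | s ∈ S ∧ ¬ G.Adj v s} d d')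
    (had : G.Adj a d) (hcd' : G.Adj c d') : False := by
  obtain ⟨n, p, hp, hD, hA, hC⟩ := exists_indPath_sets {s | G.Adj a s} {s | G.Adj c s} hd had
    hcd' hdd'
  refine false_of_cap_edge h.noCap (n := n) ?_ hp hac ?_ ?_ hva hvc ?_
  · by_contra hn
    obtain rfl : n = 0 := by omega
    exact h.noTriangle a ha c hc (p 0) (hD 0 le_rfl).1 hac ((hA 0 le_rfl).2 rfl)
      ((hC 0 le_rfl).2 rfl)
  · exact fun i hi => ⟨fun he => (hD i hi).2 (he ▸ hva), hA i hi⟩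
  · exact fun i hi => ⟨fun he => (hD i hi).2 (he ▸ hvc), hC i hi⟩
  · exact fun i hi => ⟨fun he => hvS (he ▸ (hD i hi).1), (hD i hi).2⟩

/-- Let two nonadjacent neighbours `a`, `b` of `v` attach to the same connected piece of
non-neighbours of `v`. Then every neighbour of `v` and `a` is adjacent to `b`. -/
lemma adj_of_attach (h : IsAtomIn G S) (hvS : v ∉ S) {a b c d d' : V} (ha : a ∈ S) (hc : c ∈ S)
    (hva : G.Adj v a) (hvb : G.Adj v b) (hvc : G.Adj v c) (hab : a ≠ b)
    (hnab : ¬ G.Adj a b) (hac : G.Adj a c) (hd : d ∈ S ∧ ¬ G.Adj v d)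
    (hdd' : Linked G {s | s ∈ S ∧ ¬ G.Adj v s} d d') (had : G.Adj a d) (hbd' : G.Adj b d') :
    G.Adj b c := by
  by_contra hbc
  obtain ⟨n, p, hp, hD, hA, hB⟩ := exists_indPath_sets {s | G.Adj b s} {s | G.Adj a s}
    (hdd'.mem hd) hbd' had hdd'.symm
  have hbp : ∀ i ≤ n, b ≠ p i ∧ (G.Adj b (p i) ↔ i = 0) :=
    fun i hi => ⟨fun he => (hD i hi).2 (he ▸ hvb), hA i hi⟩
  have hcp : ∀ i ≤ n, ¬ G.Adj c (p i) := fun i hi hci =>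
    h.false_of_adj_attach hvS ha hc hva hvc hac (hD n le_rfl)
      ((linked_of_walk hD (fun i hi => hp.adj_succ hi) le_rfl).symm.trans
        (linked_of_walk hD (fun i hi => hp.adj_succ hi) hi))
      ((hB n le_rfl).2 rfl) hci
  refine false_of_cap_edge h.noCap (n := n + 1) (by omega) (hp.cons hbp) hva ?_ ?_ hvc.symm
    hac.symm ?_
  · rintro (_ | i) hi
    · exact ⟨hvb.ne, by simpa using hvb⟩
    · have := hD i (by omega)
      exact ⟨fun he => hvS (he ▸ this.1), by simpa using this.2⟩
  · rintro (_ | i) hi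
    · exact ⟨hab, by simpa using hnab⟩
    · have := hD i (by omega)
      refine ⟨fun he => this.2 (by rw [consSeq_succ] at he; exact he ▸ hva), ?_⟩
      simp only [consSeq_succ, Nat.add_right_cancel_iff]
      exact hB i (by omega)
  · rintro (_ | i) hi
    · exact ⟨fun he => hnab (by rw [consSeq_zero] at he; exact he ▸ hac),
        fun h' => hbc (by simpa using h'.symm)⟩
    · exact ⟨fun he => (hD i (by omega)).2 (by rw [consSeq_succ] at he; exact he ▸ hvc),
        hcp i (by omega)⟩

/-- If `v` has two adjacent neighbours in the atom, then a neighbour of `v` in the atom with a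
neighbour outside `N(v)` has at most one neighbour inside `N(v)`. -/
lemma adj_unique_of_attach (h : IsAtomIn G S) (hvS : v ∉ S) {x y : V} (hx : x ∈ S) (hy : y ∈ S)
    (hvx : G.Adj v x) (hvy : G.Adj v y) (hxy : G.Adj x y) {a c c' d : V} (ha : a ∈ S)
    (hva : G.Adj v a) (hd : d ∈ S ∧ ¬ G.Adj v d) (had : G.Adj a d)
    (hc : c ∈ S) (hvc : G.Adj v c) (hac : G.Adj a c)
    (hc' : c' ∈ S) (hvc' : G.Adj v c') (hac' : G.Adj a c') : c = c' := by
  -- Since `{a}` is no cutset, the piece of `d` has a second attachment `b`.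
  obtain ⟨b, hb, hvb, hba, d', hdd', hbd'⟩ : ∃ b ∈ S, G.Adj v b ∧ b ≠ a ∧ ∃ d',
      Linked G {s | s ∈ S ∧ ¬ G.Adj v s} d d' ∧ G.Adj b d' := by
    by_contra! hcon
    have key := h.atomOn {a} {s | Linked G {s | s ∈ S ∧ ¬ G.Adj v s} d s} (by simpa using ha)
      (fun s hs => (hs.mem hd).1) (Set.pairwise_singleton _ _) ⟨d, Relation.ReflTransGen.refl⟩
      ?_ ?_
    · have hall : ∀ s ∈ S, G.Adj v s → s = a := fun s hs hvs => by
        by_contra hsa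
        exact ((key s hs hsa).mem hd).2 hvs
      exact hxy.ne ((hall x hx hvx).trans (hall y hy hvy).symm)
    · rintro s hs rfl
      exact (hs.mem hd).2 hva
    · intro s hs t ht hta hst
      refine Linked.step hs hd ⟨ht, fun hvt => ?_⟩ hst
      exact hcon t ht hvt hta s hs hst.symm
  have hnab : ¬ G.Adj a b := fun hab =>
    h.false_of_adj_attach hvS ha hb hva hvb hab hd hdd' had hbd'
  exact h.common_adj_unique hc hc' ha hba.symm hnab hac hac'
    (h.adj_of_attach hvS ha hc hva hvb hvc hba.symm hnab hac hd hdd' had hbd')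
    (h.adj_of_attach hvS ha hc' hva hvb hvc' hba.symm hnab hac' hd hdd' had hbd')

/-- A vertex outside the atom with two adjacent neighbours in it is complete to the atom, or its
neighbourhood there is the closed neighbourhood of a single vertex. -/
lemma complete_or_twin (h : IsAtomIn G S) (hvS : v ∉ S) {x y : V} (hx : x ∈ S) (hy : y ∈ S)
    (hvx : G.Adj v x) (hvy : G.Adj v y) (hxy : G.Adj x y) :
    (∀ s ∈ S, G.Adj v s) ∨ ∃ c ∈ S, ∀ s ∈ S, G.Adj v s ↔ (s = c ∨ G.Adj c s) := by
  by_cases hcontact : ∃ a ∈ S, G.Adj v a ∧ (∃ d ∈ S, ¬ G.Adj v d ∧ G.Adj a d) ∧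
      ∃ c ∈ S, G.Adj v c ∧ G.Adj a c
  · right
    obtain ⟨a, ha, hva, ⟨d, hd, hvd, had⟩, c, hc, hvc, hac⟩ := hcontact
    refine ⟨c, hc, ?_⟩
    -- The leaves at `c` of `N(v)`, and the pieces outside `N(v)` attached to them.
    let L : Set V := {s | s ∈ S ∧ G.Adj v s ∧ G.Adj s c ∧
      ∀ t ∈ S, G.Adj v t → G.Adj s t → t = c}
    let A : Set V := L ∪ {s | ∃ l ∈ L, ∃ d, (d ∈ S ∧ ¬ G.Adj v d) ∧ G.Adj l d ∧
      Linked G {s | s ∈ S ∧ ¬ G.Adj v s} d s}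
    have haL : a ∈ L := ⟨ha, hva, hac, fun t ht hvt hat =>
      h.adj_unique_of_attach hvS hx hy hvx hvy hxy ha hva ⟨hd, hvd⟩ had ht hvt hat hc hvc hac⟩
    have key := h.atomOn {c} A (by simpa using hc) ?_ (Set.pairwise_singleton _ _)
      ⟨a, Or.inl haL⟩ ?_ ?_
    · intro s hs
      constructor
      · intro hvs
        by_cases hsc : s = c
        · exact Or.inl hsc
        · rcases key s hs hsc with hsL | ⟨l, hl, e, he, hle, hes⟩
          · exact Or.inr hsL.2.2.1.symm
          · exact absurd hvs (hes.mem he).2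
      · rintro (rfl | hcs)
        · exact hvc
        · by_contra hvs
          rcases key s hs hcs.ne.symm with hsL | ⟨l, hl, e, he, hle, hes⟩
          · exact hvs hsL.2.1
          · exact h.false_of_adj_attach hvS hl.1 hc hl.2.1 hvc hl.2.2.1 he hes hle hcs
    · rintro s (hs | ⟨l, hl, e, he, hle, hes⟩)
      · exact hs.1
      · exact (hes.mem he).1
    · rintro s (hs | ⟨l, hl, e, he, hle, hes⟩) rfl
      · exact G.loopless.irrefl _ hs.2.2.1
      · exact (hes.mem he).2 hvc
    · rintro s (hs | ⟨l, hl, e, he, hle, hes⟩) b hb hbc hsb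
      · by_cases hvb : G.Adj v b
        · exact absurd (hs.2.2.2 b hb hvb hsb) hbc
        · exact Or.inr ⟨s, hs, b, ⟨hb, hvb⟩, hsb, Relation.ReflTransGen.refl⟩
      · by_cases hvb : G.Adj v b
        · left
          -- `b` and `l` attach to the same piece, hence have the same neighbours in `N(v)`.
          by_cases hlb : l = b
          · exact hlb ▸ hl
          have hnlb : ¬ G.Adj l b := fun hlb =>
            h.false_of_adj_attach hvS hl.1 hb hl.2.1 hvb hlb he hes hle hsb.symm
          have hbc' := h.adj_of_attach hvS hl.1 hc hl.2.1 hvb hvc hlb hnlb hl.2.2.1 he hes hle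
            hsb.symm
          exact ⟨hb, hvb, hbc', fun t ht hvt hbt =>
            h.adj_unique_of_attach hvS hx hy hvx hvy hxy hb hvb (hes.mem he) hsb.symm ht hvt hbt
              hc hvc hbc'⟩
        · exact Or.inr ⟨l, hl, e, he, hle, hes.step he ⟨hb, hvb⟩ hsb⟩
  · left
    push Not at hcontact
    have key := h.atomOn ∅ {s | s ∈ S ∧ G.Adj v s ∧ ∃ c ∈ S, G.Adj v c ∧ G.Adj s c}
      (Set.empty_subset _) (fun s hs => hs.1) (by simp) ⟨x, hx, hvx, y, hy, hvy, hxy⟩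
      (fun _ _ => Set.notMem_empty _) ?_
    · exact fun s hs => (key s hs (Set.notMem_empty _)).2.1
    · rintro s ⟨hs, hvs, c, hc, hvc, hsc⟩ b hb - hsb
      have hvb : G.Adj v b := by
        by_contra hvb
        exact hcontact s hs hvs ⟨b, hb, hvb, hsb⟩ c hc hvc hsc
      exact ⟨hb, hvb, s, hs, hvs, hsb.symm⟩

end Attach

end IsAtomIn

/-! ### Twins of the vertices of an atom -/

/-- The vertices `v` (in or outside `S`) whose closed neighbourhood in `S` is that of `u`. For an
atom `S`, this is the clique that replaces the vertex `u` of `S`. -/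
def twinClass {V : Type*} (G : SimpleGraph V) (S : Set V) (u : V) : Set V :=
  {v | ∀ s ∈ S, (s = v ∨ G.Adj v s) ↔ (s = u ∨ G.Adj u s)}

lemma mem_twinClass_self {V : Type*} (G : SimpleGraph V) (S : Set V) (u : V) :
    u ∈ twinClass G S u := fun _ _ => Iff.rfl

namespace IsAtomIn

variable {V : Type*} {G : SimpleGraph V} {S : Set V} {u u' v w : V}

lemma eq_of_mem_twinClass (h : IsAtomIn G S) (hu : u ∈ S) (hv : v ∈ twinClass G S u)
    (hvS : v ∈ S) : v = u := by
  rcases (hv v hvS).1 (Or.inl rfl) with rfl | huv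
  · rfl
  · obtain ⟨b, hb, hbv, hub⟩ := h.exists_adj_ne hu v
    exact ((hv b hb).2 (Or.inr hub)).elim (fun hb => absurd hb hbv)
      (fun hvb => (h.noTriangle u hu v hvS b hb huv hub hvb).elim)

lemma twinClass_injOn (h : IsAtomIn G S) (hu : u ∈ S) (hu' : u' ∈ S)
    (hv : v ∈ twinClass G S u) (hv' : v ∈ twinClass G S u') : u = u' :=
  h.eq_of_mem_twinClass hu' (fun s hs => (hv s hs).symm.trans (hv' s hs)) hu

lemma twin_adj (h : IsAtomIn G S) (hu : u ∈ S) (hv : v ∈ twinClass G S u) {a : V} (ha : a ∈ S)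
    (hua : G.Adj u a) : G.Adj v a := by
  rcases (hv a ha).2 (Or.inr hua) with rfl | hva
  · exact absurd (h.eq_of_mem_twinClass hu hv ha) hua.ne.symm
  · exact hva

lemma twin_not_adj (hv : v ∈ twinClass G S u) {a : V} (ha : a ∈ S) (hau : a ≠ u)
    (hua : ¬ G.Adj u a) : ¬ G.Adj v a :=
  fun hva => ((hv a ha).1 (Or.inr hva)).elim hau hua

lemma twin_adj_self (hu : u ∈ S) (hv : v ∈ twinClass G S u) (hvu : v ≠ u) : G.Adj v u :=
  ((hv u hu).2 (Or.inl rfl)).elim (fun h => absurd h.symm hvu) id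

lemma twin_notMem (h : IsAtomIn G S) (hu : u ∈ S) (hv : v ∈ twinClass G S u) (hvu : v ≠ u) :
    v ∉ S := fun hvS => hvu (h.eq_of_mem_twinClass hu hv hvS)

lemma twin_adj_iff (h : IsAtomIn G S) (hu : u ∈ S) (hv : v ∈ twinClass G S u) {a : V}
    (ha : a ∈ S) (hau : a ≠ u) : G.Adj v a ↔ G.Adj u a :=
  ⟨fun hva => by_contra fun hua => twin_not_adj hv ha hau hua hva, h.twin_adj hu hv ha⟩

/-- A 4-hole through two nonadjacent neighbours of `u` is the obstruction to two vertices complete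
to the neighbourhood of `u` being nonadjacent. -/
lemma adj_of_complete (h : IsAtomIn G S) (hu : u ∈ S) (hvw : v ≠ w)
    (hv : ∀ a ∈ S, G.Adj u a → G.Adj v a) (hw : ∀ a ∈ S, G.Adj u a → G.Adj w a) :
    G.Adj v w := by
  obtain ⟨a, ha, b, hb, hab, hua, hub, hnab⟩ := h.exists_two_adj hu
  by_contra hnvw
  exact false_of_fourHole h.noFourHole (hv a ha hua) (hw a ha hua).symm (hw b hb hub)
    (hv b hb hub).symm hnvw hnab hvw hab

lemma twin_not_complete (h : IsAtomIn G S) (hu : u ∈ S) (hv : v ∈ twinClass G S u) :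
    ¬ ∀ s ∈ S, G.Adj v s := by
  obtain ⟨s, hs, hsu, hus⟩ := h.exists_not_adj hu
  exact fun hall => twin_not_adj hv hs hsu hus (hall s hs)

/-- Any two vertices `u`, `u'` of the atom are joined by a path in it that has at least two inner
vertices and is induced except, possibly, for the edge `u u'`. Here `p` consists of the inner
vertices. -/
lemma exists_indPath (h : IsAtomIn G S) (hu : u ∈ S) (hu' : u' ∈ S) (huu' : u ≠ u') :
    ∃ (n : ℕ) (p : ℕ → V), 1 ≤ n ∧ IsIndPath G n p ∧ (∀ i ≤ n, p i ∈ S) ∧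
      (∀ i ≤ n, u ≠ p i ∧ (G.Adj u (p i) ↔ i = 0)) ∧
      (∀ i ≤ n, u' ≠ p i ∧ (G.Adj u' (p i) ↔ i = n)) := by
  let D : Set V := {s | s ∈ S ∧ s ≠ u ∧ s ≠ u' ∧ ¬ (G.Adj u s ∧ G.Adj u' s)}
  have hlink : ∃ a ∈ D, ∃ b, G.Adj u a ∧ G.Adj u' b ∧ Linked G D a b := by
    by_contra! hcon
    let A : Set V := {s | s = u ∨ s ∈ D ∧ ∃ a ∈ D, G.Adj u a ∧ Linked G D a s}
    have hAS : A ⊆ S := by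
      rintro s (rfl | hs)
      · exact hu
      · exact hs.1.1
    have step : ∀ s ∈ A, ∀ t ∈ D, G.Adj s t → t ∈ A := by
      rintro s (rfl | ⟨hs, a, ha, hua, has⟩) t ht hst
      · exact Or.inr ⟨ht, t, ht, hst, Relation.ReflTransGen.refl⟩
      · exact Or.inr ⟨ht, a, ha, hua, has.step ha ht hst⟩
    by_cases hadj : G.Adj u u'
    · obtain ⟨b, hb, hbu, hub⟩ := h.exists_adj_ne hu' u
      have := h.atomOn {u'} A (by simpa using hu') hAS (Set.pairwise_singleton _ _)
        ⟨u, Or.inl rfl⟩ ?_ ?_ b hb hub.ne.symm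
      · rcases this with rfl | ⟨-, a, ha, hua, hab⟩
        · exact hbu rfl
        · exact hcon a ha b hua hub hab
      · rintro s (rfl | hs)
        · exact huu'
        · exact hs.1.2.2.1
      · intro s hs t ht htu' hst
        by_cases htu : t = u
        · exact Or.inl htu
        · exact step s hs t ⟨ht, htu, htu', fun hc =>
            h.noTriangle u hu u' hu' t ht hadj hc.1 hc.2⟩ hst
    · have := h.atomOn {s | s ∈ S ∧ G.Adj u s ∧ G.Adj u' s} A (fun s hs => hs.1) hAS ?_
        ⟨u, Or.inl rfl⟩ ?_ ?_ u' hu' (fun hc => hadj hc.2.1)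
      · rcases this with h' | h'
        · exact huu' h'.symm
        · exact h'.1.2.2.1 rfl
      · rintro s ⟨hs, hus, hus'⟩ t ⟨ht, hut, hut'⟩ hst
        exact absurd (h.common_adj_unique hs ht hu huu' hadj hus hut hus' hut') hst
      · rintro s (rfl | hs) hc
        · exact G.loopless.irrefl _ hc.2.1
        · exact hs.1.2.2.2 hc.2
      · intro s hs t ht htK hst
        by_cases htu : t = u
        · exact Or.inl htu
        by_cases htu' : t = u'
        · subst htu'
          rcases hs with rfl | ⟨hs, a, ha, hua, has⟩
          · exact absurd hst hadj
          · exact absurd has (hcon a ha s hua hst.symm)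
        · exact step s hs t ⟨ht, htu, htu', fun hc => htK ⟨ht, hc⟩⟩ hst
  obtain ⟨a, ha, b, hua, hub, hab⟩ := hlink
  obtain ⟨n, p, hp, hD, hA, hB⟩ := exists_indPath_sets {s | G.Adj u s} {s | G.Adj u' s} ha hua
    hub hab
  refine ⟨n, p, ?_, hp, fun i hi => (hD i hi).1, fun i hi => ⟨(hD i hi).2.1.symm, hA i hi⟩,
    fun i hi => ⟨(hD i hi).2.2.1.symm, hB i hi⟩⟩
  by_contra hn
  obtain rfl : n = 0 := by omega
  exact (hD 0 le_rfl).2.2.2 ⟨(hA 0 le_rfl).2 rfl, (hB 0 le_rfl).2 rfl⟩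

/-- On a path between `u` and `u'` in the atom, `u` can be replaced by a twin. -/
lemma twin_path (h : IsAtomIn G S) (hu : u ∈ S) (hv : v ∈ twinClass G S u) {n k : ℕ} {p : ℕ → V}
    (hS : ∀ i ≤ n, p i ∈ S) (hp : ∀ i ≤ n, u ≠ p i ∧ (G.Adj u (p i) ↔ i = k)) :
    ∀ i ≤ n, v ≠ p i ∧ (G.Adj v (p i) ↔ i = k) := fun i hi =>
  ⟨fun he => (hp i hi).1 ((h.eq_of_mem_twinClass hu hv (he ▸ hS i hi)).symm.trans he),
    (h.twin_adj_iff hu hv (hS i hi) (hp i hi).1.symm).trans (hp i hi).2⟩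

lemma twin_adj_twin (h : IsAtomIn G S) (hu : u ∈ S) (hu' : u' ∈ S) (hv : v ∈ twinClass G S u)
    (hw : w ∈ twinClass G S u') (hadj : G.Adj u u') : G.Adj v w := by
  by_cases hwu' : w = u'
  · exact hwu' ▸ h.twin_adj hu hv hu' hadj
  by_contra hnvw
  have hwv : w ≠ v := fun he => hadj.ne (h.twinClass_injOn hu hu' (he ▸ hv) hw)
  obtain ⟨n, p, hn, hp, hS, hup, hup'⟩ := h.exists_indPath hu hu' hadj.ne
  exact false_of_cap_last h.noCap hn hp (h.twin_adj hu hv hu' hadj) (h.twin_path hu hv hS hup)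
    hup' ⟨hwv, fun hc => hnvw hc.symm⟩ (twin_adj_self hu' hw hwu') (h.twin_path hu' hw hS hup')

lemma twin_not_adj_twin (h : IsAtomIn G S) (hu : u ∈ S) (hu' : u' ∈ S)
    (hv : v ∈ twinClass G S u) (hw : w ∈ twinClass G S u') (huu' : u ≠ u')
    (hadj : ¬ G.Adj u u') : ¬ G.Adj v w := by
  intro hvw
  have hvu' : ¬ G.Adj v u' := twin_not_adj hv hu' huu'.symm hadj
  by_cases hwu' : w = u'
  · exact hvu' (hwu' ▸ hvw)
  have huv' : u' ≠ v := fun he => huu' (h.eq_of_mem_twinClass hu hv (he ▸ hu') ▸ he.symm)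
  obtain ⟨n, p, hn, hp, hS, hup, hup'⟩ := h.exists_indPath hu hu' huu'
  exact false_of_cap_last h.noCap hn hp hvw (h.twin_path hu hv hS hup)
    (h.twin_path hu' hw hS hup') ⟨huv', fun hc => hvu' hc.symm⟩ (twin_adj_self hu' hw hwu').symm
    hup'

lemma twin_adj_twin_iff (h : IsAtomIn G S) (hu : u ∈ S) (hu' : u' ∈ S)
    (hv : v ∈ twinClass G S u) (hw : w ∈ twinClass G S u') :
    G.Adj v w ↔ (u = u' ∧ v ≠ w) ∨ G.Adj u u' := by
  constructor
  · intro hvw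
    by_cases huu' : u = u'
    · exact Or.inl ⟨huu', hvw.ne⟩
    · exact Or.inr (by_contra fun hadj => h.twin_not_adj_twin hu hu' hv hw huu' hadj hvw)
  · rintro (⟨rfl, hvw⟩ | hadj)
    · exact h.adj_of_complete hu hvw (fun a ha => h.twin_adj hu hv ha)
        (fun a ha => h.twin_adj hu hw ha)
    · exact h.twin_adj_twin hu hu' hv hw hadj

/-- Let `u`, `u'` be distinct nonadjacent vertices of the atom, and let a connected piece of a set
`D` disjoint from the atom join a twin `x ≠ u` of `u` to a member `y` of the class of `u'`. If `D`
misses `u` and all neighbours of `u` that are not neighbours of `u'`, then a shortest path from `x`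
through the piece, `y` and the atom to the neighbourhood of `u` closes to a hole with an edge
`r x`, and `u` sees exactly `r` and `x` on it. -/
lemma false_of_link (h : IsAtomIn G S) (hu : u ∈ S) (hu' : u' ∈ S) (huu' : u ≠ u')
    (hadj : ¬ G.Adj u u') {x y : V} (hx : x ∈ twinClass G S u) (hxu : x ≠ u)
    (hy : y ∈ twinClass G S u') {D : Set V} (hDS : ∀ d ∈ D, d ∉ S) (hxD : x ∉ D)
    (hDu : ∀ d ∈ D, ¬ G.Adj u d)
    (hDr : ∀ d ∈ D, ∀ r ∈ S, G.Adj u r → ¬ G.Adj u' r → ¬ G.Adj r d)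
    {d d' : V} (hd : d ∈ D) (hdd' : Linked G D d d') (hxd : G.Adj x d) (hyd' : G.Adj y d') :
    False := by
  have hxS : x ∉ S := h.twin_notMem hu hx hxu
  have hxy : ¬ G.Adj x y := h.twin_not_adj_twin hu hu' hx hy huu' hadj
  have hxny : x ≠ y := fun he => huu' (h.twinClass_injOn hu hu' hx (he ▸ hy))
  have huny : u ≠ y := fun he =>
    huu' (h.twinClass_injOn hu hu' (mem_twinClass_self G S u) (he ▸ hy))
  have huy : ¬ G.Adj u y := fun he => twin_not_adj hy hu huu' (fun he' => hadj he'.symm) he.symm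
  let E : Set V := {s | s ∈ D ∨ s = y ∨ (s ∈ S ∧ s ≠ u ∧ s ≠ u' ∧ ¬ G.Adj u s)}
  let B : Set V := {s | ∃ r ∈ S, G.Adj u r ∧ ¬ G.Adj u' r ∧ G.Adj r s}
  have hdE : d ∈ E := Or.inl hd
  have hDE : ∀ s, Linked G D d s → Linked G E d s := fun s hs =>
    Relation.ReflTransGen.mono (fun a b hab => ⟨Or.inl hab.1, Or.inl hab.2.1, hab.2.2⟩) _ _ hs
  obtain ⟨b, hbB, hdb⟩ : ∃ b ∈ B, Linked G E d b := by
    by_contra! hcon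
    have hdy : Linked G E d y := (hDE d' hdd').step hdE (Or.inr (Or.inl rfl)) hyd'.symm
    have key := h.atomOn {s | s ∈ S ∧ G.Adj u s ∧ G.Adj u' s}
      {s | s = u' ∨ (s ∈ S ∧ s ≠ u ∧ s ≠ u' ∧ ¬ G.Adj u s) ∧ Linked G E d s}
      (fun s hs => hs.1) ?_ ?_ ⟨u', Or.inl rfl⟩ ?_ ?_ u hu (fun hc => G.loopless.irrefl _ hc.2.1)
    · exact key.elim huu' (fun hc => hc.1.2.1 rfl)
    · rintro s (rfl | hs)
      · exact hu'
      · exact hs.1.1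
    · rintro s ⟨hs, hus, hus'⟩ t ⟨ht, hut, hut'⟩ hst
      exact absurd (h.common_adj_unique hs ht hu huu' hadj hus hut hus' hut') hst
    · rintro s (rfl | hs) hc
      · exact hadj hc.2.1
      · exact hs.1.2.2.2 hc.2.1
    · intro s hs t ht htK hst
      by_cases htu' : t = u'
      · exact Or.inl htu'
      -- Some linked vertex, `s` itself or `y` in place of `u'`, is adjacent to `t`.
      obtain ⟨s', hds', hst'⟩ : ∃ s', Linked G E d s' ∧ G.Adj s' t := by
        rcases hs with rfl | hs
        · exact ⟨y, hdy, h.twin_adj hu' hy ht hst⟩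
        · exact ⟨s, hs.2, hst⟩
      have htu : t ≠ u := by
        rintro rfl
        rcases hs with rfl | hs
        · exact hadj hst.symm
        · exact hs.1.2.2.2 hst.symm
      have hut : ¬ G.Adj u t := fun hut =>
        hcon s' ⟨t, ht, hut, fun hc => htK ⟨ht, hut, hc⟩, hst'.symm⟩ hds'
      exact Or.inr ⟨⟨ht, htu, htu', hut⟩,
        hds'.step hdE (Or.inr (Or.inr ⟨ht, htu, htu', hut⟩)) hst'⟩
  obtain ⟨n, q, hq, hE, hA, hB⟩ := exists_indPath_sets {s | G.Adj x s} B hdE hxd hbB hdb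
  obtain ⟨r, hr, hur, hur', hrq⟩ := (hB n le_rfl).2 rfl
  have hxE : x ∉ E := by
    rintro (hc | hc | hc)
    · exact hxD hc
    · exact hxny hc
    · exact hxS hc.1
  have hrE : r ∉ E := by
    rintro (hc | rfl | hc)
    · exact hDS r hc hr
    · exact huy hur
    · exact hc.2.2.2 hur
  have huE : u ∉ E := by
    rintro (hc | hc | hc)
    · exact hDS u hc hu
    · exact huny hc
    · exact hc.2.1 rfl
  have huE' : ∀ s ∈ E, ¬ G.Adj u s := by
    rintro s (hc | rfl | hc)
    · exact hDu s hc
    · exact huy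
    · exact hc.2.2.2
  refine false_of_cap_edge h.noCap (n := n) ?_ hq (h.twin_adj hu hx hr hur)
    (fun i hi => ⟨fun he => hxE (he ▸ hE i hi), hA i hi⟩)
    (fun i hi => ⟨fun he => hrE (he ▸ hE i hi), fun hri => (hB i hi).1 ⟨r, hr, hur, hur', hri⟩, ?_⟩)
    (twin_adj_self hu hx hxu).symm hur
    (fun i hi => ⟨fun he => huE (he ▸ hE i hi), huE' _ (hE i hi)⟩)
  · by_contra hn
    obtain rfl : n = 0 := by omega
    have hx0 : G.Adj x (q 0) := (hA 0 le_rfl).2 rfl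
    rcases hE 0 le_rfl with hc | hc | hc
    · exact hDr _ hc r hr hur hur' hrq
    · exact hxy (hc ▸ hx0)
    · exact twin_not_adj hx hc.1 hc.2.1 hc.2.2.2 hx0
  · rintro rfl
    exact hrq

/-- Let `z` have exactly one neighbour `t` in the atom. If `z` is adjacent to a member of the class
of `u`, then `t = u`. -/
lemma eq_of_adj_twin (h : IsAtomIn G S) (hu : u ∈ S) {x z t : V} (hx : x ∈ twinClass G S u)
    (hzS : z ∉ S) (hz : ∀ s ∈ S, G.Adj z s → s = t) (ht : t ∈ S) (hzt : G.Adj z t)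
    (hzx : G.Adj z x) : t = u := by
  by_contra htu
  have hzu : ¬ G.Adj z u := fun hzu => htu (hz u hu hzu).symm
  have hxu : x ≠ u := fun he => hzu (he ▸ hzx)
  by_cases hadj : G.Adj u t
  · obtain ⟨n, p, hn, hp, hS, hup, htp⟩ := h.exists_indPath hu ht hadj.ne
    refine false_of_cap_edge h.noCap hn hp (h.twin_adj hu hx ht hadj) (h.twin_path hu hx hS hup)
      htp hzx hzt (fun i hi => ⟨fun he => hzS (he ▸ hS i hi), fun hzp => ?_⟩)
    exact (htp i hi).1 (hz _ (hS i hi) hzp).symm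
  · refine h.false_of_link hu ht (Ne.symm htu) hadj hx hxu (mem_twinClass_self G S t) (D := {z})
      (by simpa using hzS) (fun he => hzx.ne (by simpa using he.symm)) ?_ ?_ rfl
      Relation.ReflTransGen.refl hzx.symm hzt.symm
    · rintro _ rfl hc
      exact hzu hc.symm
    · rintro _ rfl r hr hur htr hrz
      exact hadj (hz r hr hrz.symm ▸ hur)

end IsAtomIn

/-! ### Enlarging an atom -/

section Union

variable {V : Type*} {G : SimpleGraph V} {S : Set V}

/-- Adding a set `P` to `S` creates no clique cutset, provided that no clique separates a part of
`P` from `S`. -/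
lemma AtomOn.union (h : AtomOn G S) {P : Set V}
    (hP : ∀ K B : Set V, G.IsClique K → B ⊆ P → B.Nonempty → (∀ b ∈ B, b ∉ K) →
      (∀ b ∈ B, ∀ c ∈ P, c ∉ K → G.Adj b c → c ∈ B) → ∃ b ∈ B, ∃ s ∈ S, s ∉ K ∧ G.Adj b s) :
    AtomOn G (S ∪ P) := by
  intro K A _ hA hK hne hAK hcl
  have hSA : ∀ s ∈ S, s ∉ K → s ∈ A := by
    have hAS : (A ∩ S).Nonempty := by
      by_contra hempty
      have hnot : ∀ a ∈ A, a ∉ S := fun a ha haS => hempty ⟨a, ha, haS⟩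
      obtain ⟨b, hb, s, hs, hsK, hbs⟩ := hP K A hK (fun a ha => (hA ha).resolve_left (hnot a ha))
        hne hAK (fun b hb c hc hcK hbc => hcl b hb c (Or.inr hc) hcK hbc)
      exact hempty ⟨s, hcl b hb s (Or.inl hs) hsK hbs, hs⟩
    intro s hs hsK
    exact (h (K ∩ S) (A ∩ S) Set.inter_subset_right Set.inter_subset_right
      (hK.subset Set.inter_subset_left) hAS (fun a ha hc => hAK a ha.1 hc.1)
      (fun a ha b hb hbK hab => ⟨hcl a ha.1 b (Or.inl hb) (fun hc => hbK ⟨hc, hb⟩) hab, hb⟩)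
      s hs (fun hc => hsK hc.1)).1
  rintro b (hb | hb) hbK
  · exact hSA b hb hbK
  by_contra hbA
  obtain ⟨c, ⟨hcP, hcK, hcA⟩, s, hs, hsK, hcs⟩ := hP K {c | c ∈ P ∧ c ∉ K ∧ c ∉ A} hK
    (fun c hc => hc.1) ⟨b, hb, hbK, hbA⟩ (fun c hc => hc.2.1)
    (fun c hc d hd hdK hcd => ⟨hd, hdK, fun hdA => hc.2.2 (hcl d hdA c (Or.inr hc.1) hc.2.1
      hcd.symm)⟩)
  exact hcA (hcl s (hSA s hs hsK) c (Or.inr hcP) hcK hcs.symm)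

lemma noTriangle_union {P : Set V}
    (hS : ∀ a ∈ S, ∀ b ∈ S, ∀ c ∈ S, G.Adj a b → G.Adj a c → G.Adj b c → False)
    (h1 : ∀ p ∈ P, ∀ a ∈ S, ∀ b ∈ S, G.Adj p a → G.Adj p b → G.Adj a b → False)
    (h2 : ∀ p ∈ P, ∀ q ∈ P, ∀ a ∈ S, G.Adj p q → G.Adj p a → G.Adj q a → False)
    (h3 : ∀ a ∈ P, ∀ b ∈ P, ∀ c ∈ P, G.Adj a b → G.Adj a c → G.Adj b c → False) :
    ∀ a ∈ S ∪ P, ∀ b ∈ S ∪ P, ∀ c ∈ S ∪ P, G.Adj a b → G.Adj a c → G.Adj b c → False := by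
  rintro a (ha | ha) b (hb | hb) c (hc | hc) hab hac hbc
  · exact hS a ha b hb c hc hab hac hbc
  · exact h1 c hc a ha b hb hac.symm hbc.symm hab
  · exact h1 b hb a ha c hc hab.symm hbc hac
  · exact h2 b hb c hc a ha hbc hab.symm hac.symm
  · exact h1 a ha b hb c hc hab hac hbc
  · exact h2 a ha c hc b hb hac hab hbc.symm
  · exact h2 a ha b hb c hc hab hac hbc
  · exact h3 a ha b hb c hc hab hac hbc

/-- A vertex adjacent to the first but not to the second vertex of an induced path is not adjacent
to two consecutive vertices of the path: otherwise the first such pair gives a cap. -/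
lemma false_of_consecutive (hG : ¬ ContainsCap G) {n : ℕ} {q : ℕ → V} (hq : IsIndPath G n q)
    {t : V} (ht : ∀ i ≤ n, t ≠ q i) (h0 : G.Adj t (q 0)) (h1 : ¬ G.Adj t (q 1)) (k : ℕ)
    (hk : k + 1 ≤ n) (htk : G.Adj t (q k)) (htk' : G.Adj t (q (k + 1))) : False := by
  induction k with
  | zero => exact h1 htk'
  | succ k ih =>
    have htk0 : ¬ G.Adj t (q k) := fun hc => ih (by omega) hc htk
    obtain ⟨j, hj, htj, hmax⟩ : ∃ j ≤ k, G.Adj t (q j) ∧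
        ∀ i, j < i → i ≤ k → ¬ G.Adj t (q i) := by
      classical
      exact ⟨Nat.findGreatest (fun i => G.Adj t (q i)) k, Nat.findGreatest_le _,
        Nat.findGreatest_spec (P := fun i => G.Adj t (q i)) (Nat.zero_le k) h0,
        fun i hi hik => Nat.findGreatest_is_greatest hi hik⟩
    have hjk : j ≠ k := fun he => htk0 (he ▸ htj)
    obtain ⟨m, hm⟩ : ∃ m, k + 1 = j + m := ⟨k + 1 - j, by omega⟩
    refine false_of_cap hG (n := m) (by omega) (hq.shift (k := j) (m := m) (by omega)).reverse
      (v := t) (x := q (k + 1 + 1)) ?_ htk'.symm ?_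
    · intro i hi
      refine ⟨ht _ (by omega), fun hti => ?_, ?_⟩
      · by_contra hne
        exact hmax (j + (m - i)) (by omega) (by omega) hti
      · rintro (rfl | rfl)
        · simpa [← hm] using htk
        · simpa using htj
    · intro i hi
      have := hq (j + (m - i)) (k + 1 + 1) (by omega) (by omega)
      exact ⟨this.1.symm, (G.adj_comm _ _).trans (this.2.trans (by omega))⟩

end Union

section Maximal

variable {V : Type*} {G : SimpleGraph V} {S : Set V}

lemma isAtomIn_of_maximal (hG : CapFourHoleFree G) (hmax : Maximal (IsTriangleFreeAtom G) S) :
    IsAtomIn G S :=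
  ⟨hG.1, hG.2, hmax.prop.1, cliqueFree_induce_iff.1 hmax.prop.2.1,
    not_hasCliqueCutset_induce_iff.1 hmax.prop.2.2⟩

/-- The vertices that are neither twins of a vertex of `S` nor complete to `S`. -/
def residue {V : Type*} (G : SimpleGraph V) (S : Set V) : Set V :=
  {z | (∀ u ∈ S, z ∉ twinClass G S u) ∧ ¬ ∀ s ∈ S, G.Adj z s}

lemma notMem_of_mem_residue {z : V} (hz : z ∈ residue G S) : z ∉ S :=
  fun hzS => hz.1 z hzS (mem_twinClass_self G S z)

variable [Finite V]

lemma subset_of_maximal (hmax : Maximal (IsTriangleFreeAtom G) S) {P : Set V}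
    (htri : ∀ a ∈ S ∪ P, ∀ b ∈ S ∪ P, ∀ c ∈ S ∪ P, G.Adj a b → G.Adj a c → G.Adj b c → False)
    (hatom : AtomOn G (S ∪ P)) : P ⊆ S := by
  have h3 : 3 ≤ (S ∪ P).ncard :=
    hmax.prop.1.trans (Set.ncard_le_ncard Set.subset_union_left (Set.toFinite _))
  exact Set.subset_union_right.trans (hmax.le_of_ge ⟨h3, cliqueFree_induce_iff.2 htri,
    not_hasCliqueCutset_induce_iff.2 hatom⟩ Set.subset_union_left)

lemma residue_adj_unique (hG : CapFourHoleFree G) (hmax : Maximal (IsTriangleFreeAtom G) S)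
    {z a b : V} (hz : z ∈ residue G S) (ha : a ∈ S) (hb : b ∈ S) (hza : G.Adj z a)
    (hzb : G.Adj z b) : a = b := by
  have h := isAtomIn_of_maximal hG hmax
  have hzS := notMem_of_mem_residue hz
  have hind : ∀ s ∈ S, ∀ t ∈ S, G.Adj z s → G.Adj z t → ¬ G.Adj s t := by
    intro s hs t ht hzs hzt hst
    rcases h.complete_or_twin hzS hs ht hzs hzt hst with hc | ⟨c, hc, hzc⟩
    · exact hz.2 hc
    · refine hz.1 c hc fun r hr => ?_
      rw [← hzc r hr]
      exact or_iff_right fun he => hzS (he ▸ hr)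
  by_contra hab
  -- The neighbourhood of `z` in `S` is independent, so `S ∪ {z}` is a larger atom.
  refine hzS (subset_of_maximal hmax (P := {z}) (noTriangle_union h.noTriangle ?_ ?_ ?_)
    (h.atomOn.union ?_) rfl)
  · rintro _ rfl s hs t ht hzs hzt hst
    exact hind s hs t ht hzs hzt hst
  · rintro _ rfl _ rfl s hs hzz
    exact (G.loopless.irrefl _ hzz).elim
  · rintro _ rfl _ rfl s hs hzz
    exact (G.loopless.irrefl _ hzz).elim
  · rintro K B hK hB ⟨c, hc⟩ hBK -
    obtain rfl : c = z := hB hc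
    by_cases haK : a ∈ K
    · exact ⟨c, hc, b, hb, fun hbK => hind a ha b hb hza hzb (hK haK hbK hab), hzb⟩
    · exact ⟨c, hc, a, ha, haK, hza⟩

/-- An induced path outside the maximal atom `S` whose ends attach to two nonadjacent vertices `u`,
`u'` of `S`, and whose inner vertices attach only to common neighbours of `u` and `u'`, enlarges
the atom. -/
lemma false_of_ear (hG : CapFourHoleFree G) (hmax : Maximal (IsTriangleFreeAtom G) S) {u u' : V}
    (hu : u ∈ S) (hu' : u' ∈ S) (huu' : u ≠ u') (hadj : ¬ G.Adj u u') {n : ℕ} {p : ℕ → V}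
    (hp : IsIndPath G n p) (hS : ∀ i ≤ n, p i ∉ S)
    (h0 : ∀ s ∈ S, G.Adj (p 0) s ↔ s = u) (hn : ∀ s ∈ S, G.Adj (p n) s ↔ s = u')
    (hinner : ∀ i, 0 < i → i < n → ∀ s ∈ S, G.Adj (p i) s → G.Adj u s ∧ G.Adj u' s)
    (huniq : ∀ i ≤ n, ∀ s ∈ S, ∀ t ∈ S, G.Adj (p i) s → G.Adj (p i) t → s = t) : False := by
  have h := isAtomIn_of_maximal hG hmax
  have hpu : ∀ i ≤ n, u ≠ p i ∧ (G.Adj u (p i) ↔ i = 0) := by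
    refine fun i hi => ⟨fun he => hS i hi (he ▸ hu), fun hc => ?_, ?_⟩
    · by_contra hi0
      rcases hi.lt_or_eq with hin | rfl
      · exact G.loopless.irrefl _ (hinner i (by omega) hin u hu hc.symm).1
      · exact huu' ((hn u hu).1 hc.symm)
    · rintro rfl
      exact ((h0 u hu).2 rfl).symm
  have hpu' : ∀ i ≤ n, u' ≠ p i ∧ (G.Adj u' (p i) ↔ i = n) := by
    refine fun i hi => ⟨fun he => hS i hi (he ▸ hu'), fun hc => ?_, ?_⟩
    · by_contra hin
      rcases Nat.eq_zero_or_pos i with rfl | hi0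
      · exact huu' ((h0 u' hu').1 hc.symm).symm
      · exact G.loopless.irrefl _ (hinner i hi0 (by omega) u' hu' hc.symm).2
    · rintro rfl
      exact ((hn u' hu').2 rfl).symm
  have hpath : IsIndPath G (n + 1) (consSeq u p) := hp.cons hpu
  have hcons : ∀ i < n, ∀ t ∈ S, G.Adj (p i) t → G.Adj (p (i + 1)) t → False := by
    intro i hi t ht hit hit'
    have hi0 : i ≠ 0 := by
      rintro rfl
      obtain rfl := (h0 t ht).1 hit
      have := (hpu (0 + 1) (by omega)).2.1 hit'.symm
      omega
    have htuu' := hinner i (by omega) hi t ht hit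
    refine false_of_consecutive h.noCap hpath (t := t) ?_ htuu'.1.symm ?_ (i + 1) (by omega)
      hit.symm hit'.symm
    · rintro (_ | j) hj
      · exact htuu'.1.ne.symm
      · exact fun he => hS j (by omega) (by rw [consSeq_succ] at he; exact he ▸ ht)
    · exact fun hc => htuu'.1.ne ((h0 t ht).1 hc.symm).symm
  refine hS 0 (by omega) (subset_of_maximal hmax (P := {x | ∃ i ≤ n, p i = x})
    (noTriangle_union h.noTriangle ?_ ?_ ?_) (h.atomOn.union ?_) ⟨0, by omega, rfl⟩)
  · rintro _ ⟨i, hi, rfl⟩ a ha b hb hia hib hab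
    exact hab.ne (huniq i hi a ha b hb hia hib)
  · rintro _ ⟨i, hi, rfl⟩ _ ⟨j, hj, rfl⟩ t ht hij hit hjt
    rcases lt_trichotomy i j with hlt | rfl | hlt
    · obtain rfl := (hp i j hlt hj).2.1 hij
      exact hcons i (by omega) t ht hit hjt
    · exact G.loopless.irrefl _ hij
    · obtain rfl := (hp j i hlt hi).2.1 hij.symm
      exact hcons j (by omega) t ht hjt hit
  · have key : ∀ i j, i ≤ n → j ≤ n → G.Adj (p i) (p j) → j = i + 1 ∨ i = j + 1 := by
      intro i j hi hj hij
      rcases lt_trichotomy i j with hlt | rfl | hlt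
      · exact Or.inl ((hp i j hlt hj).2.1 hij)
      · exact (G.loopless.irrefl _ hij).elim
      · exact Or.inr ((hp j i hlt hi).2.1 hij.symm)
    rintro _ ⟨i, hi, rfl⟩ _ ⟨j, hj, rfl⟩ _ ⟨k, hk, rfl⟩ hij hik hjk
    have h1 := key i j hi hj hij
    have h2 := key i k hi hk hik
    have h3 := key j k hj hk hjk
    omega
  · rintro K B hK hB ⟨b, hb⟩ hBK hcl
    by_contra! hcon
    obtain ⟨i₀, hi₀, rfl⟩ := hB hb
    -- The first and the last vertex of the path in `B` are cut off by vertices of the clique.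
    have hlow : u ∈ K ∨ ∃ j, j < i₀ ∧ p j ∈ K := by
      by_contra! hc
      have : ∀ d ≤ i₀, p (i₀ - d) ∈ B := by
        intro d
        induction d with
        | zero => exact fun _ => hb
        | succ d ih =>
          intro hd
          have hs := hp.adj_succ (i := i₀ - (d + 1)) (by omega)
          rw [show i₀ - (d + 1) + 1 = i₀ - d by omega] at hs
          exact hcl _ (ih (by omega)) _ ⟨i₀ - (d + 1), by omega, rfl⟩ (hc.2 _ (by omega)) hs.symm
      have h00 := this i₀ le_rfl
      rw [Nat.sub_self] at h00
      exact hcon _ h00 u hu hc.1 ((h0 u hu).2 rfl)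
    have hhigh : u' ∈ K ∨ ∃ j, i₀ < j ∧ j ≤ n ∧ p j ∈ K := by
      by_contra! hc
      have : ∀ d, i₀ + d ≤ n → p (i₀ + d) ∈ B := by
        intro d
        induction d with
        | zero => exact fun _ => hb
        | succ d ih =>
          intro hd
          exact hcl _ (ih (by omega)) _ ⟨i₀ + (d + 1), hd, rfl⟩ (hc.2 _ (by omega) hd)
            (hp.adj_succ (i := i₀ + d) (by omega))
      have hnn := this (n - i₀) (by omega)
      rw [Nat.add_sub_cancel' hi₀] at hnn
      exact hcon _ hnn u' hu' hc.1 ((hn u' hu').2 rfl)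
    rcases hlow with huK | ⟨j, hj, hjK⟩ <;> rcases hhigh with huK' | ⟨k, hk, hkn, hkK⟩
    · exact hadj (hK huK huK' huu')
    · have := (hpu k hkn).2.1 (hK huK hkK (hpu k hkn).1)
      omega
    · have := (hpu' j (by omega)).2.1 (hK huK' hjK (hpu' j (by omega)).1)
      omega
    · have := (hp j k (by omega) hkn).2.1 (hK hjK hkK (hp j k (by omega) hkn).1)
      omega

/-- No component of the residue attaches to two nonadjacent classes. -/
lemma false_of_residue_link (hG : CapFourHoleFree G) (hmax : Maximal (IsTriangleFreeAtom G) S)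
    {u u' x y a b : V} (hu : u ∈ S) (hu' : u' ∈ S) (huu' : u ≠ u') (hadj : ¬ G.Adj u u')
    (hx : x ∈ twinClass G S u) (hy : y ∈ twinClass G S u') (ha : a ∈ residue G S)
    (hab : Linked G (residue G S) a b) (hax : G.Adj a x) (hby : G.Adj b y) : False := by
  have h := isAtomIn_of_maximal hG hmax
  obtain ⟨n, p, hp, hD, ⟨u, u', hu, hu', huu', hadj, ⟨x, hx, h0x⟩, ⟨y, hy, hny⟩⟩, hmin⟩ :=
    exists_indPath_rel (fun a b => ∃ u u', u ∈ S ∧ u' ∈ S ∧ u ≠ u' ∧ ¬ G.Adj u u' ∧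
      (∃ x ∈ twinClass G S u, G.Adj a x) ∧ ∃ y ∈ twinClass G S u', G.Adj b y) ha
      ⟨u, u', hu, hu', huu', hadj, ⟨x, hx, hax⟩, ⟨y, hy, hby⟩⟩ hab
  have hpS : ∀ i ≤ n, p i ∉ S := fun i hi => notMem_of_mem_residue (hD i hi)
  have huniq : ∀ i ≤ n, ∀ s ∈ S, ∀ t ∈ S, G.Adj (p i) s → G.Adj (p i) t → s = t :=
    fun i hi s hs t ht => residue_adj_unique hG hmax (hD i hi) hs ht
  have hfirst : ∀ s ∈ S, G.Adj (p 0) s → s = u := fun s hs hs0 =>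
    h.eq_of_adj_twin hu hx (hpS 0 (by omega))
      (fun t ht ht0 => huniq 0 (by omega) t ht s hs ht0 hs0) hs hs0 h0x
  have hlast : ∀ s ∈ S, G.Adj (p n) s → s = u' := fun s hs hsn =>
    h.eq_of_adj_twin hu' hy (hpS n le_rfl)
      (fun t ht htn => huniq n le_rfl t ht s hs htn hsn) hs hsn hny
  have hinner : ∀ i, 0 < i → i < n → ∀ s ∈ S, G.Adj (p i) s → G.Adj u s ∧ G.Adj u' s := by
    intro i hi0 hin s hs his
    have h1 : s = u ∨ G.Adj u s := by
      by_contra! hc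
      have := hmin 0 i (by omega) (by omega) ⟨u, s, hu, hs, hc.1.symm, hc.2, ⟨x, hx, h0x⟩,
        ⟨s, mem_twinClass_self G S s, his⟩⟩
      omega
    have h2 : s = u' ∨ G.Adj u' s := by
      by_contra! hc
      have := hmin i n (by omega) le_rfl ⟨s, u', hs, hu', hc.1, fun hc' => hc.2 hc'.symm,
        ⟨s, mem_twinClass_self G S s, his⟩, ⟨y, hy, hny⟩⟩
      omega
    rcases h1 with rfl | h1
    · exact absurd h2 (not_or.2 ⟨huu', fun hc => hadj hc.symm⟩)
    · rcases h2 with rfl | h2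
      · exact absurd h1 hadj
      · exact ⟨h1, h2⟩
  -- The attachments in `S` of a vertex of the path.
  have hatt : ∀ i ≤ n, ∀ s ∈ S, G.Adj (p i) s →
      (i = 0 ∧ s = u) ∨ (i = n ∧ s = u') ∨ (G.Adj u s ∧ G.Adj u' s) := by
    intro i hi s hs his
    rcases Nat.eq_zero_or_pos i with rfl | hi0
    · exact Or.inl ⟨rfl, hfirst s hs his⟩
    · rcases hi.lt_or_eq with hin | rfl
      · exact Or.inr (Or.inr (hinner i hi0 hin s hs his))
      · exact Or.inr (Or.inl ⟨rfl, hlast s hs his⟩)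
  let P : Set V := {z | ∃ i ≤ n, p i = z}
  have hPS : ∀ d ∈ P, d ∉ S := by
    rintro _ ⟨i, hi, rfl⟩
    exact hpS i hi
  have hlink : Linked G P (p 0) (p n) :=
    linked_of_walk (D := P) (fun i hi => ⟨i, hi, rfl⟩) (fun i hi => hp.adj_succ hi) le_rfl
  have h0u : G.Adj (p 0) u := by
    by_contra hc
    refine h.false_of_link hu hu' huu' hadj hx (fun he => hc (he ▸ h0x)) hy (D := P) hPS ?_ ?_ ?_
      ⟨0, by omega, rfl⟩ hlink h0x.symm hny.symm
    · rintro ⟨i, hi, rfl⟩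
      exact (hD i hi).1 u hu hx
    · rintro _ ⟨i, hi, rfl⟩ hui
      rcases hatt i hi u hu hui.symm with ⟨rfl, -⟩ | ⟨-, he⟩ | ⟨he, -⟩
      · exact hc hui.symm
      · exact huu' he
      · exact G.loopless.irrefl _ he
    · rintro _ ⟨i, hi, rfl⟩ r hr hur hur' hri
      rcases hatt i hi r hr hri.symm with ⟨-, rfl⟩ | ⟨-, rfl⟩ | ⟨-, he⟩
      · exact G.loopless.irrefl _ hur
      · exact hadj hur
      · exact hur' he
  have hnu' : G.Adj (p n) u' := by
    by_contra hc
    refine h.false_of_link hu' hu huu'.symm (fun he => hadj he.symm) hy (fun he => hc (he ▸ hny)) hx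
      (D := P) hPS ?_ ?_ ?_ ⟨n, le_rfl, rfl⟩ hlink.symm hny.symm h0x.symm
    · rintro ⟨i, hi, rfl⟩
      exact (hD i hi).1 u' hu' hy
    · rintro _ ⟨i, hi, rfl⟩ hui
      rcases hatt i hi u' hu' hui.symm with ⟨-, he⟩ | ⟨rfl, -⟩ | ⟨-, he⟩
      · exact huu' he.symm
      · exact hc hui.symm
      · exact G.loopless.irrefl _ he
    · rintro _ ⟨i, hi, rfl⟩ r hr hur hur' hri
      rcases hatt i hi r hr hri.symm with ⟨-, rfl⟩ | ⟨-, rfl⟩ | ⟨he, -⟩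
      · exact hadj hur.symm
      · exact G.loopless.irrefl _ hur
      · exact hur' he
  exact false_of_ear hG hmax hu hu' huu' hadj hp hpS
    (fun s hs => ⟨hfirst s hs, fun he => he ▸ h0u⟩) (fun s hs => ⟨hlast s hs, fun he => he ▸ hnu'⟩)
    hinner huniq

/-! ### The decomposition -/

lemma IsAtomIn.adj_of_twin_or_complete {V : Type*} {G : SimpleGraph V} {S : Set V}
    (h : IsAtomIn G S) {v w : V} (hvw : v ≠ w) (hv : ∀ s ∈ S, G.Adj v s)
    (hw : (∃ u ∈ S, w ∈ twinClass G S u) ∨ ∀ s ∈ S, G.Adj w s) : G.Adj v w := by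
  rcases hw with ⟨u, hu, hw⟩ | hw
  · exact h.adj_of_complete hu hvw (fun a ha _ => hv a ha) (fun a ha => h.twin_adj hu hw ha)
  · obtain ⟨u, hu, -⟩ := h.exists_mem_ne_ne v v
    exact h.adj_of_complete hu hvw (fun a ha _ => hv a ha) (fun a ha _ => hw a ha)

/-- The neighbourhood of a component of the residue is a clique, hence a cutset of `G`; so the
residue is empty. -/
lemma twin_or_complete (hG : CapFourHoleFree G) (hcut : ¬ HasCliqueCutset G)
    (hmax : Maximal (IsTriangleFreeAtom G) S) (v : V) :
    (∃ u ∈ S, v ∈ twinClass G S u) ∨ ∀ s ∈ S, G.Adj v s := by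
  have h := isAtomIn_of_maximal hG hmax
  have hres : ∀ w, w ∉ residue G S → (∃ u ∈ S, w ∈ twinClass G S u) ∨ ∀ s ∈ S, G.Adj w s := by
    intro w hw
    by_contra! hc
    exact hw ⟨hc.1, by simpa using hc.2⟩
  refine hres v fun hv => ?_
  let K : Set V := {w | w ∉ residue G S ∧ ∃ c, Linked G (residue G S) v c ∧ G.Adj c w}
  have hK : G.IsClique K := by
    rintro w ⟨hw, c, hvc, hcw⟩ w' ⟨hw', c', hvc', hcw'⟩ hne
    rcases hres w hw with ⟨u, hu, hwu⟩ | hwall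
    · rcases hres w' hw' with ⟨u', hu', hwu'⟩ | hwall'
      · by_contra hnadj
        rw [h.twin_adj_twin_iff hu hu' hwu hwu'] at hnadj
        push Not at hnadj
        exact false_of_residue_link hG hmax hu hu' (fun he => hne (hnadj.1 he)) hnadj.2 hwu hwu'
          (hvc.mem hv) (hvc.symm.trans hvc') hcw hcw'
      · exact (h.adj_of_twin_or_complete hne.symm hwall' (hres w hw)).symm
    · exact h.adj_of_twin_or_complete hne hwall (hres w' hw')
  have key := not_hasCliqueCutset_iff.1 hcut K {c | Linked G (residue G S) v c} hK
    ⟨v, Relation.ReflTransGen.refl⟩ (fun c hc hcK => hcK.1 (hc.mem hv)) ?_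
  · -- All of `S` lies in the clique `K`, although `S` has nonadjacent vertices.
    have hSK : ∀ s ∈ S, s ∈ K := fun s hs => by
      by_contra hsK
      exact notMem_of_mem_residue ((key s hsK).mem hv) hs
    obtain ⟨u, hu, -⟩ := h.exists_mem_ne_ne v v
    obtain ⟨s, hs, hsu, hus⟩ := h.exists_not_adj hu
    exact hus (hK (hSK u hu) (hSK s hs) hsu.symm)
  · intro c hc b hbK hcb
    by_cases hb : b ∈ residue G S
    · exact Linked.step hc hv hb hcb
    · exact absurd ⟨hb, c, hc, hcb⟩ hbK

end Maximal

theorem exists_iso_of_maximal {V : Type u} [Finite V] (G : SimpleGraph V)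
    (hG : CapFourHoleFree G) (hcut : ¬ HasCliqueCutset G) (S : Set V)
    (hmax : Maximal (IsTriangleFreeAtom G) S) :
    ∃ (K : S → Type u) (U : Type u) (e : addUniversalClique (blowUp (G.induce S) K) U ≃g G),
      ∀ u : S, ∃ k : K u, e (Sum.inl ⟨u, k⟩) = u := by
  have h := isAtomIn_of_maximal hG hmax
  have hall := twin_or_complete hG hcut hmax
  let f : (Σ u : S, twinClass G S (u : V)) ⊕ {v : V // ∀ s ∈ S, G.Adj v s} → V :=
    Sum.elim (fun q => q.2) (fun v => v)
  have hf : Function.Bijective f := by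
    constructor
    · rintro (⟨⟨u, hu⟩, ⟨v, hv⟩⟩ | ⟨v, hv⟩) (⟨⟨u', hu'⟩, ⟨v', hv'⟩⟩ | ⟨v', hv'⟩) hvv'
      · obtain rfl : v = v' := hvv'
        obtain rfl := h.twinClass_injOn hu hu' hv hv'
        rfl
      · obtain rfl : v = v' := hvv'
        exact (h.twin_not_complete hu hv hv').elim
      · obtain rfl : v = v' := hvv'
        exact (h.twin_not_complete hu' hv' hv).elim
      · obtain rfl : v = v' := hvv'
        rfl
    · intro v
      rcases hall v with ⟨u, hu, hv⟩ | hv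
      · exact ⟨Sum.inl ⟨⟨u, hu⟩, ⟨v, hv⟩⟩, rfl⟩
      · exact ⟨Sum.inr ⟨v, hv⟩, rfl⟩
  refine ⟨fun u => twinClass G S (u : V), {v : V // ∀ s ∈ S, G.Adj v s},
    ⟨Equiv.ofBijective f hf, ?_⟩, fun u => ⟨⟨u, mem_twinClass_self G S u⟩, rfl⟩⟩
  have hcomplete : ∀ v w, v ≠ w → (∀ s ∈ S, G.Adj v s) → G.Adj v w := fun v w hvw hv =>
    h.adj_of_twin_or_complete hvw hv (hall w)
  rintro (⟨⟨u, hu⟩, ⟨v, hv⟩⟩ | ⟨v, hv⟩) (⟨⟨u', hu'⟩, ⟨v', hv'⟩⟩ | ⟨v', hv'⟩)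
  · refine (h.twin_adj_twin_iff hu hu' hv hv').trans
      (or_congr ⟨?_, ?_⟩ Iff.rfl)
    · rintro ⟨rfl, hne⟩
      exact ⟨rfl, fun he => hne (congrArg (fun q => (q.2 : V)) he)⟩
    · rintro ⟨he, hne⟩
      obtain rfl : u = u' := congrArg Subtype.val he
      refine ⟨rfl, ?_⟩
      rintro rfl
      exact hne rfl
  · refine iff_of_true (hcomplete v' v ?_ hv').symm trivial
    rintro rfl
    exact h.twin_not_complete hu hv hv'
  · refine iff_of_true (hcomplete v v' ?_ hv) trivial
    rintro rfl
    exact h.twin_not_complete hu' hv' hv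
  · refine ⟨fun hadj he => hadj.ne (congrArg Subtype.val he), fun hne => ?_⟩
    exact hcomplete v v' (fun he => hne (Subtype.ext he)) hv

/-! ### Blowing up vertices and adding a universal clique -/

lemma cycleGraph_adj_iff_val {n : ℕ} (i j : Fin n) :
    (SimpleGraph.cycleGraph n).Adj i j ↔ i.val ≠ j.val ∧ (j.val = i.val + 1 ∨ i.val = j.val + 1 ∨
      (i.val = 0 ∧ j.val + 1 = n) ∨ (j.val = 0 ∧ i.val + 1 = n)) := by
  rcases lt_trichotomy i j with h | rfl | h
  · rw [cycleGraph_adj_of_lt h]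
    have : i.val < j.val := h
    omega
  · simp
  · rw [SimpleGraph.adj_comm, cycleGraph_adj_of_lt h]
    have : j.val < i.val := h
    omega

lemma exists_not_adj_cycleGraph {n : ℕ} (hn : 4 ≤ n) (i : Fin n) :
    ∃ j, i ≠ j ∧ ¬ (SimpleGraph.cycleGraph n).Adj i j := by
  have hi := i.2
  obtain ⟨k, hk, hik⟩ : ∃ k < n, k = i.val + 2 ∨ k + n = i.val + 2 := by
    by_cases h : i.val + 2 < n
    · exact ⟨_, h, Or.inl rfl⟩
    · exact ⟨i.val + 2 - n, by omega, by omega⟩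
  refine ⟨⟨k, hk⟩, fun h => ?_, ?_⟩
  · have : i.val = k := congrArg Fin.val h
    omega
  · rw [cycleGraph_adj_iff_val]
    dsimp only
    omega

lemma exists_adj_not_adj_cycleGraph {n : ℕ} (hn : 4 ≤ n) {i j : Fin n}
    (hij : (SimpleGraph.cycleGraph n).Adj i j) :
    ∃ k, k ≠ j ∧ (SimpleGraph.cycleGraph n).Adj k i ∧ ¬ (SimpleGraph.cycleGraph n).Adj k j := by
  have hi := i.2
  have hj := j.2
  rw [cycleGraph_adj_iff_val] at hij
  -- One of the two neighbours of `i` on the cycle is `j`; take the other one.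
  obtain ⟨k, hk, hik⟩ : ∃ k < n, ((j.val = i.val + 1 ∨ (j.val = 0 ∧ i.val + 1 = n)) ∧
      ((i.val = 0 ∧ k + 1 = n) ∨ k + 1 = i.val)) ∨
      ((i.val = j.val + 1 ∨ (i.val = 0 ∧ j.val + 1 = n)) ∧
      (k = i.val + 1 ∨ (k = 0 ∧ i.val + 1 = n))) := by
    by_cases h : j.val = i.val + 1 ∨ (j.val = 0 ∧ i.val + 1 = n)
    · by_cases h0 : i.val = 0
      · exact ⟨n - 1, by omega, by omega⟩
      · exact ⟨i.val - 1, by omega, by omega⟩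
    · by_cases hn : i.val + 1 = n
      · exact ⟨0, by omega, by omega⟩
      · exact ⟨i.val + 1, by omega, by omega⟩
  refine ⟨⟨k, hk⟩, fun h => ?_, ?_, ?_⟩
  · have : k = j.val := congrArg Fin.val h
    omega
  · rw [cycleGraph_adj_iff_val]
    dsimp only
    omega
  · rw [cycleGraph_adj_iff_val]
    dsimp only
    omega

/-- The map `π` exhibits `G` as a blow-up of `F` with a universal clique added: `π a = some u` if
`a` lies in the clique replacing `u`, and `π a = none` if `a` lies in the universal clique. -/
structure IsBlowUpMap {V W : Type*} (G : SimpleGraph V) (F : SimpleGraph W) (π : V → Option W) :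
    Prop where
  adj_of_none : ∀ a b, a ≠ b → π a = none → G.Adj a b
  adj_iff : ∀ a b u w, π a = some u → π b = some w → (G.Adj a b ↔ (u = w ∧ a ≠ b) ∨ F.Adj u w)
  surj : ∀ u, ∃ a, π a = some u

namespace IsBlowUpMap

variable {V W : Type*} {G : SimpleGraph V} {F : SimpleGraph W} {π : V → Option W}

lemma exists_some (h : IsBlowUpMap G F π) {a b : V} (hab : a ≠ b) (hnadj : ¬ G.Adj a b) :
    ∃ u, π a = some u :=
  Option.ne_none_iff_exists'.1 fun ha => hnadj (h.adj_of_none a b hab ha)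

/-- A hole of `G` avoids the universal clique and meets every blown-up clique at most once, so it
projects to a hole of `F`. -/
lemma exists_hole (h : IsBlowUpMap G F π) {n : ℕ} (hn : 4 ≤ n)
    (f : SimpleGraph.cycleGraph n ↪g G) :
    ∃ g : SimpleGraph.cycleGraph n ↪g F, ∀ i, π (f i) = some (g i) := by
  have hsome : ∀ i, ∃ u, π (f i) = some u := by
    intro i
    obtain ⟨j, hij, hnadj⟩ := exists_not_adj_cycleGraph hn i
    exact h.exists_some (f.injective.ne hij) (fun hc => hnadj (f.map_adj_iff.1 hc))
  choose g hg using hsome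
  have hinj : Function.Injective g := by
    intro i j hij
    by_contra hne
    have hadj : (SimpleGraph.cycleGraph n).Adj i j := f.map_adj_iff.1
      ((h.adj_iff _ _ _ _ (hg i) (hg j)).2 (Or.inl ⟨hij, f.injective.ne hne⟩))
    obtain ⟨k, hkj, hki, hnkj⟩ := exists_adj_not_adj_cycleGraph hn hadj
    refine hnkj (f.map_adj_iff.1 ((h.adj_iff _ _ _ _ (hg k) (hg j)).2 ?_))
    rcases (h.adj_iff _ _ _ _ (hg k) (hg i)).1 (f.map_adj_iff.2 hki) with hc | hc
    · exact Or.inl ⟨hc.1.trans hij, f.injective.ne hkj⟩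
    · exact Or.inr (hij ▸ hc)
  refine ⟨⟨⟨g, hinj⟩, ?_⟩, hg⟩
  intro i j
  refine Iff.trans ?_ f.map_adj_iff
  rw [h.adj_iff _ _ _ _ (hg i) (hg j)]
  refine ⟨Or.inr, fun hc => hc.resolve_left fun hc' => hc'.2 ?_⟩
  rw [hinj hc'.1]

lemma fourHoleFree (h : IsBlowUpMap G F π) (hF : FourHoleFree F) : FourHoleFree G :=
  ⟨fun f => hF.false (h.exists_hole le_rfl f).choose⟩

lemma not_containsCap (h : IsBlowUpMap G F π) (hF : F.CliqueFree 3) : ¬ ContainsCap G := by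
  classical
  rintro ⟨n, hn, f, x, hxf, i, j, hij, hx⟩
  obtain ⟨g, hg⟩ := h.exists_hole hn f
  have hxne : ∀ k, x ≠ f k := fun k hk => hxf ⟨k, hk.symm⟩
  have hgij : F.Adj (g i) (g j) := g.map_adj_iff.2 (f.map_adj_iff.1 hij)
  obtain ⟨k, hkj, hki, -⟩ := exists_adj_not_adj_cycleGraph hn (f.map_adj_iff.1 hij)
  obtain ⟨l, hli, hlj, -⟩ := exists_adj_not_adj_cycleGraph hn (f.map_adj_iff.1 hij).symm
  have hxk : ¬ G.Adj x (f k) := fun hc => ((hx k).1 hc).elim hki.ne hkj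
  have hxl : ¬ G.Adj x (f l) := fun hc => ((hx l).1 hc).elim hli hlj.ne
  obtain ⟨w, hw⟩ := h.exists_some (hxne k) hxk
  rcases (h.adj_iff _ _ _ _ hw (hg i)).1 ((hx i).2 (Or.inl rfl)) with ⟨rfl, -⟩ | hwi
  · exact hxk ((h.adj_iff _ _ _ _ hw (hg k)).2 (Or.inr (g.map_adj_iff.2 hki.symm)))
  · rcases (h.adj_iff _ _ _ _ hw (hg j)).1 ((hx j).2 (Or.inr rfl)) with ⟨rfl, -⟩ | hwj
    · exact hxl ((h.adj_iff _ _ _ _ hw (hg l)).2 (Or.inr (g.map_adj_iff.2 hlj.symm)))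
    · exact hF {w, g i, g j} (SimpleGraph.is3Clique_triple_iff.2 ⟨hwi, hwj, hgij⟩)

/-- A clique cutset of `G` contains the universal clique, and the vertices of `F` whose cliques it
contains form a clique cutset of `F`. -/
lemma not_hasCliqueCutset (h : IsBlowUpMap G F π) (hF : ¬ HasCliqueCutset F) :
    ¬ HasCliqueCutset G := by
  rw [not_hasCliqueCutset_iff] at hF ⊢
  rintro K A hK ⟨a, ha⟩ hAK hcl b hbK
  by_contra hbA
  have hab : a ≠ b := fun he => hbA (he ▸ ha)
  have hnab : ¬ G.Adj a b := fun hc => hbA (hcl a ha b hbK hc)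
  obtain ⟨u, hu⟩ := h.exists_some hab hnab
  obtain ⟨w, hw⟩ := h.exists_some hab.symm (fun hc => hnab hc.symm)
  have key := hF {w | ∀ a, π a = some w → a ∈ K} {w | ∃ a ∈ A, π a = some w} ?_
    ⟨u, a, ha, hu⟩ ?_ ?_ w (fun hc => hbK (hc b hw))
  · obtain ⟨c, hc, hcw⟩ := key
    have hcb : c ≠ b := fun he => hbA (he ▸ hc)
    exact hbA (hcl c hc b hbK ((h.adj_iff _ _ _ _ hcw hw).2 (Or.inl ⟨rfl, hcb⟩)))
  · intro s hs t ht hst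
    obtain ⟨c, hc⟩ := h.surj s
    obtain ⟨d, hd⟩ := h.surj t
    have hcd : c ≠ d := by
      rintro rfl
      exact hst (Option.some.inj (hc.symm.trans hd))
    exact ((h.adj_iff _ _ _ _ hc hd).1 (hK (hs c hc) (ht d hd) hcd)).resolve_left
      (fun he => hst he.1)
  · rintro s ⟨c, hc, hcs⟩ hs
    exact hAK c hc (hs c hcs)
  · rintro s ⟨c, hc, hcs⟩ t ht hst
    obtain ⟨d, hd, hdK⟩ : ∃ d, π d = some t ∧ d ∉ K := by
      by_contra! hcon
      exact ht hcon
    exact ⟨d, hcl c hc d hdK ((h.adj_iff _ _ _ _ hcs hd).2 (Or.inr hst)), hd⟩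

end IsBlowUpMap

lemma isBlowUpMap_of_iso {V W : Type*} {G : SimpleGraph V} {F : SimpleGraph W} {K : W → Type*}
    {U : Type*} [∀ u, Nonempty (K u)] (e : G ≃g addUniversalClique (blowUp F K) U) :
    IsBlowUpMap G F (fun a => Sum.elim (fun q => some q.1) (fun _ => none) (e a)) where
  adj_of_none a b hab ha := by
    rw [← e.map_adj_iff]
    have hne := e.injective.ne hab
    generalize e a = p at *
    generalize e b = q at *
    rcases p with p | p
    · exact absurd ha (Option.some_ne_none _)
    · rcases q with q | q
      · trivial
      · exact fun he => hne (congrArg Sum.inr he)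
  adj_iff a b u w ha hb := by
    rw [← e.map_adj_iff, ← e.injective.ne_iff]
    generalize e a = p at *
    generalize e b = q at *
    rcases p with p | p
    · rcases q with q | q
      · obtain rfl := Option.some.inj ha
        obtain rfl := Option.some.inj hb
        exact or_congr (and_congr Iff.rfl Sum.inl_injective.ne_iff.symm) Iff.rfl
      · exact absurd hb.symm (Option.some_ne_none _)
    · exact absurd ha.symm (Option.some_ne_none _)
  surj u := ⟨e.symm (Sum.inl ⟨u, Classical.arbitrary _⟩), by simp⟩

end CapFree

theorem theorem3p5 :
    -- Every maximal induced subgraph `F = G[S]` as described yields `G`; the clique replacing the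
    -- vertex `u` of `F` contains `u` itself.
    (∀ {V : Type u} [Finite V] (G : SimpleGraph V),
      CapFree.CapFourHoleFree G → CapFree.ContainsHole G → ¬ CapFree.HasCliqueCutset G →
      ∀ S : Set V, Maximal (CapFree.IsTriangleFreeAtom G) S →
        ∃ (K : S → Type u) (U : Type u)
          (e : CapFree.addUniversalClique (CapFree.blowUp (G.induce S) K) U ≃g G),
          ∀ u : S, ∃ k : K u, e (Sum.inl ⟨u, k⟩) = u) ∧
    -- Conversely, every graph `G` obtained in this way has the stated properties.
    (∀ {W : Type v} [Finite W] (F : SimpleGraph W),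
      F.CliqueFree 3 → CapFree.FourHoleFree F → 3 ≤ Nat.card W → ¬ CapFree.HasCliqueCutset F →
      ∀ (K : W → Type w) (U : Type x) [∀ u, Finite (K u)] [∀ u, Nonempty (K u)] [Finite U]
        {V : Type u} (G : SimpleGraph V),
        Nonempty (G ≃g CapFree.addUniversalClique (CapFree.blowUp F K) U) →
        CapFree.CapFourHoleFree G ∧ ¬ CapFree.HasCliqueCutset G) := by
  refine ⟨fun G hG _ hcut S hmax => CapFree.exists_iso_of_maximal G hG hcut S hmax, ?_⟩
  rintro W _ F hF3 hF4 - hFcut K U _ _ _ V G ⟨e⟩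
  have h := CapFree.isBlowUpMap_of_iso e
  exact ⟨⟨h.not_containsCap hF3, h.fourHoleFree hF4⟩, h.not_hasCliqueCutset hFcut⟩
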